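/- **Setting.** Let $p$ be a real polynomial of degree at most $3$ in $x=(x_1,\dots,x_n)$. Consider tuples of coefficients $Z=(P^i,Q^i,P',r^i,f^i,r',w^i,g^i,w')_{i\in[n]}$ with $P^i,Q^i,P'\in\mathbb{R}^{n\times n}$ symmetric, $r^i,f^i,r'\in\mathbb{R}^n$ and $w^i,g^i,w'\in\mathbb{R}$. Let $\mathcal Z_1$ be the set of all $Z$ for which the polynomial identity $$p(x)=\sum_{i=1}^n x_i\,(x^TP^ix+x^Tr^i+w^i)+\sum_{i=1}^n(1-x_i)\,(x^TQ^ix+x^Tf^i+g^i)+x^TP'x+x^Tr'+w'$$ holds. Let this matching of coefficients be written as any finite system of linear equations $$\sum_{i=1}^n\Big(\langle A_j^i,P^i\rangle+\langle B_j^i,Q^i\rangle+(c_j^i)^Tr^i+(d_j^i)^Tf^i+\mu_j^iw^i+\nu_j^ig^i\Big)+\langle\Xi_j,P'\rangle+\omega_j^Tr'+\gamma_jw'=s_j,\quad j\in[m].$$ Let diagonal dominance of all the matrices (that is, $M_{kk}\ge\sum_{l\ne k}|M_{kl}|$ for all $k$ and each $M\in\{P^1,\dots,P^n,Q^1,\dots,Q^n,P'\}$)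 be linearized by any finite system of linear inequalities with auxiliary matrices $T^i,S^i,T'\in\mathbb{R}^{n\times n}$, $$\sum_{i=1}^n\Big(\langle\hat A_j^i,P^i\rangle+\langle\hat B_j^i,Q^i\rangle+\langle H_j^i,T^i\rangle+\langle G_j^i,S^i\rangle+(\hat c_j^i)^Tr^i+(\hat d_j^i)^Tf^i+\hat\mu_j^iw^i+\hat\nu_j^ig^i\Big)+\langle\Psi_j,T'\rangle+\langle\hat\Xi_j,P'\rangle+\hat\omega_j^Tr'+\hat\gamma_jw'\le s_j^2,\quad j\in[m_2]$$ (the $2$ in $s_j^2$ is an upper index, not a square). This means that a tuple $Z$ with symmetric matrices can be completed by some $T^i,S^i,T'$ to a solution if and only if all its matrices are diagonally dominant. The coefficient matrices $A_j^i,B_j^i,\Xi_j,\hat A_j^i,\hat B_j^i,\hat\Xi_j$ are symmetric. Let $\mathcal Z_2$ be the set of all $Z\in\mathcal Z_1$ that satisfy these inequalities for some $T^i,S^i,T'$. Let $\overline{\mathcal X}$ be a set of pairs $(x,U)$ with $x\in[0,1]^n$ and $U\in\mathbb{R}^{n\times n}$, the vector $U_i$ being the $i$-th row of $U$ (which linearizes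 $x_ix$), and put $$g_3(x,U,Z)=\sum_{i=1}^n\Big(\tfrac{U_i^TP^iU_i}{x_i}+U_i^Tr^i+w^ix_i+\tfrac{(x-U_i)^TQ^i(x-U_i)}{1-x_i}+(x-U_i)^Tf^i+(1-x_i)g^i\Big)+x^TP'x+x^Tr'+w'.$$ A quotient with denominator $0$ is read as the closure of the perspective: it is $0$ if the numerator is $0$, and $+\infty$ otherwise. For $(x,U)\in\overline{\mathcal X}$ consider the conic program in the symmetric matrices $Y^1,\dots,Y^{n+1},R^1,\dots,R^n\in\mathbb{R}^{n\times n}$ and the vectors $\lambda\in\mathbb{R}^m$, $\theta\in\mathbb{R}^{m_2}$: $$\min\ \sum_{j=1}^{m_2}\theta_js_j^2-\sum_{j=1}^m\lambda_js_j$$ subject to $\theta\ge0$ and, for all $i\in[n]$, $$\begin{aligned} &Y^i+\textstyle\sum_j\lambda_jA^i_j-\sum_j\theta_j\hat A^i_j=0,\qquad R^i+\sum_j\lambda_jB^i_j-\sum_j\theta_j\hat B^i_j=0,\qquad Y^{n+1}+\sum_j\lambda_j\Xi_j-\sum_j\theta_j\hat\Xi_j=0,\\ &U_i+\textstyle\sum_j\lambda_jc^i_j-\sum_j\theta_j\hat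 c^i_j=0,\qquad x-U_i+\sum_j\lambda_jd^i_j-\sum_j\theta_j\hat d^i_j=0,\qquad x+\sum_j\lambda_j\omega_j-\sum_j\theta_j\hat\omega_j=0,\\ &x_i+\textstyle\sum_j\lambda_j\mu^i_j-\sum_j\theta_j\hat\mu^i_j=0,\qquad 1-x_i+\sum_j\lambda_j\nu^i_j-\sum_j\theta_j\hat\nu^i_j=0,\qquad 1+\sum_j\lambda_j\gamma_j-\sum_j\theta_j\hat\gamma_j=0,\\ &\textstyle\sum_j\theta_jH^i_j=0,\qquad\sum_j\theta_jG^i_j=0,\qquad\sum_j\theta_j\Psi_j=0,\\ &\begin{pmatrix}Y^i&U_i\\U_i^T&x_i\end{pmatrix}\succeq0,\qquad\begin{pmatrix}R^i&x-U_i\\(x-U_i)^T&1-x_i\end{pmatrix}\succeq0,\qquad\begin{pmatrix}Y^{n+1}&x\\x^T&1\end{pmatrix}\succeq0. \end{aligned}$$ **Theorem.** 1. For every $(x,U)\in\overline{\mathcal X}$ the tightest lower bound $\sup_{Z\in\mathcal Z_2}g_3(x,U,Z)$ equals the optimal value of the conic program at $(x,U)$; both are $+\infty$ if the program is infeasible.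 If the program is feasible, both optima are attained and they are equal. 2. If $(x,U)\in\overline{\mathcal X}$ is a variable of the program as well, then its optimal value equals $\inf_{(x,U)\in\overline{\mathcal X}}\sup_{Z\in\mathcal Z_2}g_3(x,U,Z)$. Moreover, $(x,U)$ is an optimal solution of this min-max problem with a value $<+\infty$ if and only if there are $Y,R,\lambda,\theta$ such that $(x,U,Y,R,\lambda,\theta)$ is an optimal solution of the program. -/

import Mathlib

open MvPolynomial

/-- The quadratic polynomial `xᵀ M x + xᵀ b + c` in the variables `x_1, …, x_n`. -/
noncomputable def quadPoly {n : ℕ} (M : Matrix (Fin n) (Fin n) ℝ) (b : Fin n → ℝ) (c : ℝ) :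
    MvPolynomial (Fin n) ℝ :=
  (∑ k, ∑ l, C (M k l) * (X k * X l)) + (∑ k, C (b k) * X k) + C c

/-- The coefficients `Z = (P^i, Q^i, P', r^i, f^i, r', w^i, g^i, w')` of the quadratics of an SLC
decomposition of a cubic polynomial; `P0`, `r0`, `w0` stand for `P'`, `r'`, `w'`. -/
structure SLCCoeffs (n : ℕ) where
  P : Fin n → Matrix (Fin n) (Fin n) ℝ
  Q : Fin n → Matrix (Fin n) (Fin n) ℝ
  P0 : Matrix (Fin n) (Fin n) ℝ
  r : Fin n → Fin n → ℝ
  f : Fin n → Fin n → ℝ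
  r0 : Fin n → ℝ
  w : Fin n → ℝ
  g : Fin n → ℝ
  w0 : ℝ

/-- The matrices of the quadratic forms are symmetric. -/
def SLCCoeffs.IsSymm {n : ℕ} (Z : SLCCoeffs n) : Prop :=
  (∀ i, (Z.P i).IsSymm) ∧ (∀ i, (Z.Q i).IsSymm) ∧ Z.P0.IsSymm

/-- The polynomial `∑ x_i p_i(x) + ∑ (1 - x_i) q_i(x) + β(x)`, where `p_i`, `q_i`, `β` are the
quadratics with the coefficients `Z`. -/
noncomputable def SLCCoeffs.toPoly {n : ℕ} (Z : SLCCoeffs n) : MvPolynomial (Fin n) ℝ :=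
  (∑ i, X i * quadPoly (Z.P i) (Z.r i) (Z.w i)) +
    (∑ i, (1 - X i) * quadPoly (Z.Q i) (Z.f i) (Z.g i)) + quadPoly Z.P0 Z.r0 Z.w0

/-- Row diagonal dominance `M_kk ≥ ∑_{l ≠ k} |M_kl|`. -/
def IsDiagDominant {n : ℕ} (M : Matrix (Fin n) (Fin n) ℝ) : Prop :=
  ∀ k, ∑ l ∈ Finset.univ.erase k, |M k l| ≤ M k k

/-- All quadratics have diagonally dominant matrices. -/
def SLCCoeffs.IsDiagDominant {n : ℕ} (Z : SLCCoeffs n) : Prop :=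
  (∀ i, _root_.IsDiagDominant (Z.P i)) ∧ (∀ i, _root_.IsDiagDominant (Z.Q i)) ∧
    _root_.IsDiagDominant Z.P0

/-- The auxiliary variables `T^i, S^i, T'` that linearize `|P^i|, |Q^i|, |P'|`. -/
structure AuxVars (n : ℕ) where
  T : Fin n → Matrix (Fin n) (Fin n) ℝ
  S : Fin n → Matrix (Fin n) (Fin n) ℝ
  T0 : Matrix (Fin n) (Fin n) ℝ

/-- The inner product `⟨M, N⟩ = ∑_{k,l} M_kl N_kl` of matrices. -/
def matInner {n : ℕ} (M N : Matrix (Fin n) (Fin n) ℝ) : ℝ :=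
  ∑ k, ∑ l, M k l * N k l

/-- The coefficients of one scalar linear constraint on `Z`: `A^i, B^i, Ξ` multiply `P^i, Q^i, P'`,
`c^i, d^i, ω` multiply `r^i, f^i, r'`, and `μ^i, ν^i, γ` multiply `w^i, g^i, w'`. -/
structure LinRow (n : ℕ) where
  A : Fin n → Matrix (Fin n) (Fin n) ℝ
  B : Fin n → Matrix (Fin n) (Fin n) ℝ
  Xi : Matrix (Fin n) (Fin n) ℝ
  c : Fin n → Fin n → ℝ
  d : Fin n → Fin n → ℝ
  omega : Fin n → ℝ
  mu : Fin n → ℝ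
  nu : Fin n → ℝ
  gamma : ℝ

/-- The matrix coefficients are symmetric (they pair with symmetric matrices). -/
def LinRow.IsSymm {n : ℕ} (a : LinRow n) : Prop :=
  (∀ i, (a.A i).IsSymm) ∧ (∀ i, (a.B i).IsSymm) ∧ a.Xi.IsSymm

/-- The value of the linear form at `Z`. -/
def LinRow.eval {n : ℕ} (a : LinRow n) (Z : SLCCoeffs n) : ℝ :=
  (∑ i, (matInner (a.A i) (Z.P i) + matInner (a.B i) (Z.Q i) + a.c i ⬝ᵥ Z.r i + a.d i ⬝ᵥ Z.f i +
      a.mu i * Z.w i + a.nu i * Z.g i)) +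
    matInner a.Xi Z.P0 + a.omega ⬝ᵥ Z.r0 + a.gamma * Z.w0

/-- The linear equations `row_j (Z) = s_j`, `j ∈ ι`. -/
structure EqSystem (n : ℕ) (ι : Type*) where
  row : ι → LinRow n
  s : ι → ℝ

/-- `Z` solves all the equations. -/
def EqSystem.Holds {n : ℕ} {ι : Type*} (E : EqSystem n ι) (Z : SLCCoeffs n) : Prop :=
  ∀ j, (E.row j).eval Z = E.s j

/-- The equations express the matching of the coefficients of the polynomial `p`: they say exactly
that `p` is the SLC polynomial with coefficients `Z`. -/
def EqSystem.IsMatching {n : ℕ} {ι : Type*} (E : EqSystem n ι) (p : MvPolynomial (Fin n) ℝ) :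
    Prop :=
  (∀ j, (E.row j).IsSymm) ∧ ∀ Z : SLCCoeffs n, Z.IsSymm → (E.Holds Z ↔ Z.toPoly = p)

/-- The linear inequalities
`row_j (Z) + ∑ ⟨H_j^i, T^i⟩ + ∑ ⟨G_j^i, S^i⟩ + ⟨Ψ_j, T'⟩ ≤ s_j`, `j ∈ κ`. -/
structure IneqSystem (n : ℕ) (κ : Type*) where
  row : κ → LinRow n
  H : κ → Fin n → Matrix (Fin n) (Fin n) ℝ
  G : κ → Fin n → Matrix (Fin n) (Fin n) ℝ
  Psi : κ → Matrix (Fin n) (Fin n) ℝ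
  s : κ → ℝ

/-- `Z` together with the auxiliary variables `t` satisfies all the inequalities. -/
def IneqSystem.Holds {n : ℕ} {κ : Type*} (I : IneqSystem n κ) (Z : SLCCoeffs n) (t : AuxVars n) :
    Prop :=
  ∀ j, (I.row j).eval Z + (∑ i, (matInner (I.H j i) (t.T i) + matInner (I.G j i) (t.S i))) +
    matInner (I.Psi j) t.T0 ≤ I.s j

/-- The inequalities are a linearization of diagonal dominance: a tuple `Z` of coefficients with
symmetric matrices can be completed by auxiliary variables to a solution if and only if all of its
matrices are diagonally dominant. -/
def IneqSystem.IsGershgorin {n : ℕ} {κ : Type*} (I : IneqSystem n κ) : Prop :=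
  (∀ j, (I.row j).IsSymm) ∧
    ∀ Z : SLCCoeffs n, Z.IsSymm → ((∃ t : AuxVars n, I.Holds Z t) ↔ Z.IsDiagDominant)

/-- The set `𝒵₂` of the coefficients that satisfy the equations and, together with some auxiliary
variables, the inequalities. -/
def gershSet {n : ℕ} {ι κ : Type*} (E : EqSystem n ι) (I : IneqSystem n κ) : Set (SLCCoeffs n) :=
  {Z | Z.IsSymm ∧ E.Holds Z ∧ ∃ t : AuxVars n, I.Holds Z t}

/-- `yᵀ M y / t`, extended to `t = 0` as the closure of the perspective of the quadratic form of a
positive semidefinite matrix `M`: there it is `0` if `yᵀ M y = 0`, and `+∞` otherwise. -/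
noncomputable def quadOverLin {n : ℕ} (M : Matrix (Fin n) (Fin n) ℝ) (y : Fin n → ℝ) (t : ℝ) :
    EReal :=
  open Classical in
  if t = 0 then (if y ⬝ᵥ M.mulVec y = 0 then 0 else ⊤)
  else ((y ⬝ᵥ M.mulVec y / t : ℝ) : EReal)

/-- The convex relaxation `g₃(x, U, Z)`; `U i` is the vector `U_i`. -/
noncomputable def g3 {n : ℕ} (x : Fin n → ℝ) (U : Matrix (Fin n) (Fin n) ℝ) (Z : SLCCoeffs n) :
    EReal :=
  (∑ i, (quadOverLin (Z.P i) (U i) (x i) + ((U i ⬝ᵥ Z.r i + Z.w i * x i : ℝ) : EReal) +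
      quadOverLin (Z.Q i) (x - U i) (1 - x i) +
      (((x - U i) ⬝ᵥ Z.f i + (1 - x i) * Z.g i : ℝ) : EReal))) +
    ((x ⬝ᵥ Z.P0.mulVec x + x ⬝ᵥ Z.r0 + Z.w0 : ℝ) : EReal)

/-- The worst case `sup_{Z ∈ 𝒵₂} g₃(x, U, Z)`: the tightest of the lower bounds at `(x, U)`. -/
noncomputable def tightestBound {n : ℕ} {ι κ : Type*} (E : EqSystem n ι) (I : IneqSystem n κ)
    (z : (Fin n → ℝ) × Matrix (Fin n) (Fin n) ℝ) : EReal :=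
  ⨆ Z ∈ gershSet E I, g3 z.1 z.2 Z

/-- The `(n+1) × (n+1)` matrix `[[Y, u], [uᵀ, t]]`. -/
def borderedMatrix {n : ℕ} (Y : Matrix (Fin n) (Fin n) ℝ) (u : Fin n → ℝ) (t : ℝ) :
    Matrix (Fin n ⊕ Unit) (Fin n ⊕ Unit) ℝ :=
  Matrix.fromBlocks Y (Matrix.of fun k _ => u k) (Matrix.of fun _ k => u k) (Matrix.of fun _ _ => t)

/-- The variables `Y^1, …, Y^n`, `R^1, …, R^n`, `Y^{n+1}` (here `Y0`), `λ`, `θ` of the conic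
program. -/
structure ConicVars (n : ℕ) (ι κ : Type*) where
  Y : Fin n → Matrix (Fin n) (Fin n) ℝ
  R : Fin n → Matrix (Fin n) (Fin n) ℝ
  Y0 : Matrix (Fin n) (Fin n) ℝ
  lam : ι → ℝ
  theta : κ → ℝ

/-- The constraints of the conic program at the point `(x, U)`. -/
structure ConicFeasible {n : ℕ} {ι κ : Type*} [Fintype ι] [Fintype κ] (E : EqSystem n ι)
    (I : IneqSystem n κ) (x : Fin n → ℝ) (U : Matrix (Fin n) (Fin n) ℝ) (v : ConicVars n ι κ) :
    Prop where
  eqP : ∀ i, v.Y i + ∑ j, v.lam j • (E.row j).A i - ∑ j, v.theta j • (I.row j).A i = 0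
  eqQ : ∀ i, v.R i + ∑ j, v.lam j • (E.row j).B i - ∑ j, v.theta j • (I.row j).B i = 0
  eqP0 : v.Y0 + ∑ j, v.lam j • (E.row j).Xi - ∑ j, v.theta j • (I.row j).Xi = 0
  eqr : ∀ i, U i + ∑ j, v.lam j • (E.row j).c i - ∑ j, v.theta j • (I.row j).c i = 0
  eqf : ∀ i, x - U i + ∑ j, v.lam j • (E.row j).d i - ∑ j, v.theta j • (I.row j).d i = 0
  eqr0 : x + ∑ j, v.lam j • (E.row j).omega - ∑ j, v.theta j • (I.row j).omega = 0
  eqw : ∀ i, x i + ∑ j, v.lam j * (E.row j).mu i - ∑ j, v.theta j * (I.row j).mu i = 0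
  eqg : ∀ i, 1 - x i + ∑ j, v.lam j * (E.row j).nu i - ∑ j, v.theta j * (I.row j).nu i = 0
  eqw0 : 1 + ∑ j, v.lam j * (E.row j).gamma - ∑ j, v.theta j * (I.row j).gamma = 0
  eqT : ∀ i, ∑ j, v.theta j • I.H j i = 0
  eqS : ∀ i, ∑ j, v.theta j • I.G j i = 0
  eqT0 : ∑ j, v.theta j • I.Psi j = 0
  lmiP : ∀ i, (borderedMatrix (v.Y i) (U i) (x i)).PosSemidef
  lmiQ : ∀ i, (borderedMatrix (v.R i) (x - U i) (1 - x i)).PosSemidef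
  lmiP0 : (borderedMatrix v.Y0 x 1).PosSemidef
  theta_nonneg : ∀ j, 0 ≤ v.theta j

/-- The objective `∑ θ_j s_j² - ∑ λ_j s_j` of the conic program, where `s_j²` (with an upper index,
not a square) is the right-hand side of the `j`-th inequality. -/
def conicObj {n : ℕ} {ι κ : Type*} [Fintype ι] [Fintype κ] (E : EqSystem n ι)
    (I : IneqSystem n κ) (v : ConicVars n ι κ) : ℝ :=
  ∑ j, v.theta j * I.s j - ∑ j, v.lam j * E.s j

/-- The feasible set of the conic program in all of its variables, for `(x, U)` ranging over a set
`Xbar`. -/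
def conicSet {n : ℕ} {ι κ : Type*} [Fintype ι] [Fintype κ] (E : EqSystem n ι) (I : IneqSystem n κ)
    (Xbar : Set ((Fin n → ℝ) × Matrix (Fin n) (Fin n) ℝ)) :
    Set (((Fin n → ℝ) × Matrix (Fin n) (Fin n) ℝ) × ConicVars n ι κ) :=
  {q | q.1 ∈ Xbar ∧ ConicFeasible E I q.1.1 q.1.2 q.2}

/-- The exponent vectors with entries at most `3`. -/
noncomputable def cubicExponent {n : ℕ} (a : Fin n → Fin 4) : Fin n →₀ ℕ :=
  Finsupp.equivFunOnFinite.symm fun i => (a i : ℕ)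

/-- The equations obtained by comparing the coefficients of all monomials. -/
noncomputable def monomialEqs {n : ℕ} (p : MvPolynomial (Fin n) ℝ) :
    EqSystem n (Fin n → Fin 4) where
  row a :=
    { A := fun i => Matrix.of fun k l => coeff (cubicExponent a) (X i * (X k * X l))
      B := fun i => Matrix.of fun k l => coeff (cubicExponent a) ((1 - X i) * (X k * X l))
      Xi := Matrix.of fun k l => coeff (cubicExponent a) (X k * X l)
      c := fun i k => coeff (cubicExponent a) (X i * X k)
      d := fun i k => coeff (cubicExponent a) ((1 - X i) * X k)
      omega := fun k => coeff (cubicExponent a) (X k)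
      mu := fun i => coeff (cubicExponent a) (X i)
      nu := fun i => coeff (cubicExponent a) (1 - X i)
      gamma := coeff (cubicExponent a) 1 }
  s a := coeff (cubicExponent a) p

theorem coeff_mul_quadPoly {n : ℕ} (e : Fin n →₀ ℕ) (q : MvPolynomial (Fin n) ℝ)
    (M : Matrix (Fin n) (Fin n) ℝ) (b : Fin n → ℝ) (c : ℝ) :
    coeff e (q * quadPoly M b c) =
      matInner (Matrix.of fun k l => coeff e (q * (X k * X l))) M +
        (fun k => coeff e (q * X k)) ⬝ᵥ b + coeff e q * c := by
  have h1 : ∀ (a : ℝ) (u : MvPolynomial (Fin n) ℝ), coeff e (q * (C a * u)) = coeff e (q * u) * a := by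
    intro a u
    rw [mul_left_comm, coeff_C_mul, mul_comm]
  have h2 : coeff e (q * C c) = coeff e q * c := by
    rw [mul_comm, coeff_C_mul, mul_comm]
  simp only [quadPoly, mul_add, Finset.mul_sum, coeff_add, coeff_sum, h1, h2, matInner, dotProduct,
    Matrix.of_apply]

theorem monomialEqs_eval {n : ℕ} (p : MvPolynomial (Fin n) ℝ) (a : Fin n → Fin 4)
    (Z : SLCCoeffs n) :
    ((monomialEqs p).row a).eval Z = coeff (cubicExponent a) Z.toPoly := by
  have h := coeff_mul_quadPoly (cubicExponent a) 1 Z.P0 Z.r0 Z.w0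
  simp only [one_mul] at h
  simp only [LinRow.eval, monomialEqs, SLCCoeffs.toPoly, coeff_add, coeff_sum, coeff_mul_quadPoly, h,
    Finset.sum_add_distrib]
  ring

theorem totalDegree_quadPoly {n : ℕ} (M : Matrix (Fin n) (Fin n) ℝ) (b : Fin n → ℝ) (c : ℝ) :
    (quadPoly M b c).totalDegree ≤ 2 := by
  have hX : ∀ i : Fin n, (X i : MvPolynomial (Fin n) ℝ).totalDegree ≤ 1 := fun i => by simp
  have hC : ∀ (a : ℝ) (u : MvPolynomial (Fin n) ℝ) , (C a * u).totalDegree ≤ u.totalDegree := by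
    intro a u
    refine (totalDegree_mul _ _).trans (by simp)
  refine (totalDegree_add _ _).trans (max_le ((totalDegree_add _ _).trans (max_le ?_ ?_)) (by simp))
  · refine totalDegree_finsetSum_le fun k _ => totalDegree_finsetSum_le fun l _ => ?_
    refine (hC _ _).trans ((totalDegree_mul _ _).trans ?_)
    have := hX k
    have := hX l
    omega
  · refine totalDegree_finsetSum_le fun k _ => (hC _ _).trans ?_
    have := hX k
    omega

theorem SLCCoeffs.totalDegree_toPoly {n : ℕ} (Z : SLCCoeffs n) : Z.toPoly.totalDegree ≤ 3 := by
  have hX : ∀ i : Fin n, (X i : MvPolynomial (Fin n) ℝ).totalDegree ≤ 1 := fun i => by simp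
  refine (totalDegree_add _ _).trans (max_le ((totalDegree_add _ _).trans (max_le ?_ ?_))
    ((totalDegree_quadPoly _ _ _).trans (by norm_num)))
  · refine totalDegree_finsetSum_le fun i _ => (totalDegree_mul _ _).trans ?_
    have := hX i
    have := totalDegree_quadPoly (Z.P i) (Z.r i) (Z.w i)
    omega
  · refine totalDegree_finsetSum_le fun i _ => (totalDegree_mul _ _).trans ?_
    have h1 : (1 - X i : MvPolynomial (Fin n) ℝ).totalDegree ≤ 1 :=
      (totalDegree_sub _ _).trans (max_le (by simp) (hX i))
    have := totalDegree_quadPoly (Z.Q i) (Z.f i) (Z.g i)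
    omega

theorem monomialEqs_isMatching {n : ℕ} (p : MvPolynomial (Fin n) ℝ) (hp : p.totalDegree ≤ 3) :
    (monomialEqs p).IsMatching p := by
  refine ⟨fun a => ⟨fun i => ?_, fun i => ?_, ?_⟩, fun Z _ => ⟨fun h => ?_, fun h a => ?_⟩⟩
  · ext k l
    simp [monomialEqs, mul_comm (X k : MvPolynomial (Fin n) ℝ)]
  · ext k l
    simp only [monomialEqs, Matrix.transpose_apply, Matrix.of_apply,
      mul_comm (X k : MvPolynomial (Fin n) ℝ)]
  · ext k l
    simp only [monomialEqs, Matrix.transpose_apply, Matrix.of_apply,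
      mul_comm (X k : MvPolynomial (Fin n) ℝ)]
  · ext e
    by_cases he : ∀ i, e i < 4
    · have h3 := h fun i => ⟨e i, he i⟩
      rw [monomialEqs_eval] at h3
      have h4 : cubicExponent (fun i => (⟨e i, he i⟩ : Fin 4)) = e := by
        ext i
        simp [cubicExponent]
      simpa [monomialEqs, h4] using h3
    · push Not at he
      obtain ⟨i, hi⟩ := he
      have hlt : 3 < ∑ j ∈ e.support, e j := by
        have : e i ≤ ∑ j ∈ e.support, e j := Finset.single_le_sum (f := fun j => e j)
          (fun _ _ => Nat.zero_le _) (Finsupp.mem_support_iff.2 (by omega))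
        omega
      rw [coeff_eq_zero_of_totalDegree_lt (lt_of_le_of_lt Z.totalDegree_toPoly hlt),
        coeff_eq_zero_of_totalDegree_lt (lt_of_le_of_lt hp hlt)]
  · rw [monomialEqs_eval, h]
    rfl

/-- The linear form that pairs `M` with the `b`-th of the matrices `P^i`, `Q^i`, `P'`. -/
def blockRow {n : ℕ} (b : Fin n ⊕ Fin n ⊕ Unit) (M : Matrix (Fin n) (Fin n) ℝ) : LinRow n where
  A i := if b = .inl i then M else 0
  B i := if b = .inr (.inl i) then M else 0
  Xi := if b = .inr (.inr ()) then M else 0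
  c := 0
  d := 0
  omega := 0
  mu := 0
  nu := 0
  gamma := 0

/-- The coefficients of the matrix `M` in the inequalities `±M_kl - N_kl ≤ 0` and
`∑_{l ≠ k} N_kl - M_kk ≤ 0`, for a symmetric `M`. -/
noncomputable def absCoeffLeft {n : ℕ} :
    (Fin n × Fin n × Bool ⊕ Fin n) → Matrix (Fin n) (Fin n) ℝ
  | .inl (k, l, σ) => (if σ then 1 / 2 else -(1 / 2) : ℝ) • (.single k l 1 + .single l k 1)
  | .inr k => -.single k k 1

/-- The coefficients of the matrix `N` in these inequalities. -/
def absCoeffRight {n : ℕ} : (Fin n × Fin n × Bool ⊕ Fin n) → Matrix (Fin n) (Fin n) ℝ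
  | .inl (k, l, _) => -.single k l 1
  | .inr k => ∑ l ∈ Finset.univ.erase k, .single k l 1

/-- These inequalities for `M` each of `P^i`, `Q^i`, `P'` and `N` the corresponding one of `T^i`,
`S^i`, `T'`. -/
noncomputable def absIneqs (n : ℕ) :
    IneqSystem n ((Fin n ⊕ Fin n ⊕ Unit) × (Fin n × Fin n × Bool ⊕ Fin n)) where
  row j := blockRow j.1 (absCoeffLeft j.2)
  H j := (blockRow j.1 (absCoeffRight j.2)).A
  G j := (blockRow j.1 (absCoeffRight j.2)).B
  Psi j := (blockRow j.1 (absCoeffRight j.2)).Xi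
  s := 0

theorem matInner_zero {n : ℕ} (N : Matrix (Fin n) (Fin n) ℝ) : matInner 0 N = 0 := by
  simp [matInner]

theorem matInner_add {n : ℕ} (M M' N : Matrix (Fin n) (Fin n) ℝ) :
    matInner (M + M') N = matInner M N + matInner M' N := by
  simp [matInner, add_mul, Finset.sum_add_distrib]

theorem matInner_smul {n : ℕ} (a : ℝ) (M N : Matrix (Fin n) (Fin n) ℝ) :
    matInner (a • M) N = a * matInner M N := by
  simp [matInner, Finset.mul_sum, mul_assoc]

theorem matInner_neg {n : ℕ} (M N : Matrix (Fin n) (Fin n) ℝ) :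
    matInner (-M) N = -matInner M N := by
  simp [matInner]

theorem matInner_single {n : ℕ} (k l : Fin n) (a : ℝ) (N : Matrix (Fin n) (Fin n) ℝ) :
    matInner (.single k l a) N = a * N k l := by
  simp [matInner, Matrix.single_apply, ite_and]

theorem matInner_sum {n : ℕ} (s : Finset (Fin n)) (M : Fin n → Matrix (Fin n) (Fin n) ℝ)
    (N : Matrix (Fin n) (Fin n) ℝ) :
    matInner (∑ l ∈ s, M l) N = ∑ l ∈ s, matInner (M l) N := by
  classical
  induction s using Finset.induction_on with
  | empty => simp [matInner_zero]
  | insert a s ha ih => rw [Finset.sum_insert ha, matInner_add, ih, Finset.sum_insert ha]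

theorem abs_ineqs_iff {n : ℕ} {M : Matrix (Fin n) (Fin n) ℝ} (hM : M.IsSymm)
    (N : Matrix (Fin n) (Fin n) ℝ) :
    (∀ c, matInner (absCoeffLeft c) M + matInner (absCoeffRight c) N ≤ 0) ↔
      (∀ k l, |M k l| ≤ N k l) ∧ ∀ k, ∑ l ∈ Finset.univ.erase k, N k l ≤ M k k := by
  have e : ∀ k l, M l k = M k l := fun k l => hM.apply k l
  simp only [Sum.forall, Prod.forall, Bool.forall_bool, absCoeffLeft, absCoeffRight, matInner_smul,
    matInner_add, matInner_neg, matInner_single, matInner_sum, e, one_mul]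
  refine and_congr (forall₂_congr fun k l => ?_) (forall_congr' fun k => ?_)
  · rw [abs_le]
    simp only [Bool.false_eq_true, if_true, if_false]
    constructor <;> rintro ⟨h, h'⟩ <;> constructor <;> linarith
  · constructor <;> intro h <;> linarith

theorem matInner_ite {n : ℕ} (q : Prop) [Decidable q] (M N : Matrix (Fin n) (Fin n) ℝ) :
    matInner (if q then M else 0) N = if q then matInner M N else 0 := by
  split_ifs <;> simp [matInner_zero]

theorem absIneqs_holds_iff {n : ℕ} {Z : SLCCoeffs n} (hZ : Z.IsSymm) (t : AuxVars n) :
    (absIneqs n).Holds Z t ↔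
      (∀ i, (∀ k l, |Z.P i k l| ≤ t.T i k l) ∧
        ∀ k, ∑ l ∈ Finset.univ.erase k, t.T i k l ≤ Z.P i k k) ∧
      (∀ i, (∀ k l, |Z.Q i k l| ≤ t.S i k l) ∧
        ∀ k, ∑ l ∈ Finset.univ.erase k, t.S i k l ≤ Z.Q i k k) ∧
      (∀ k l, |Z.P0 k l| ≤ t.T0 k l) ∧
        ∀ k, ∑ l ∈ Finset.univ.erase k, t.T0 k l ≤ Z.P0 k k := by
  simp only [← abs_ineqs_iff (hZ.1 _), ← abs_ineqs_iff (hZ.2.1 _), ← abs_ineqs_iff hZ.2.2]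
  rw [IneqSystem.Holds, Prod.forall, Sum.forall, Sum.forall]
  refine and_congr ?_ (and_congr ?_ ?_) <;>
    simp [absIneqs, blockRow, LinRow.eval, matInner_ite, matInner_zero]

theorem absIneqs_isGershgorin (n : ℕ) : (absIneqs n).IsGershgorin := by
  refine ⟨fun j => ?_, fun Z hZ => ?_⟩
  · have hM : ∀ M : Matrix (Fin n) (Fin n) ℝ, M.IsSymm → (blockRow j.1 M).IsSymm := by
      intro M h
      refine ⟨fun i => ?_, fun i => ?_, ?_⟩ <;> simp only [blockRow] <;> split_ifs <;>
        first | exact h | exact Matrix.isSymm_zero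
    refine hM _ ?_
    rcases j.2 with ⟨k, l, σ⟩ | k
    · exact Matrix.IsSymm.smul (by simp [Matrix.IsSymm, add_comm]) _
    · simp [absCoeffLeft, Matrix.IsSymm]
  · simp only [absIneqs_holds_iff hZ]
    constructor
    · rintro ⟨t, h1, h2, h3⟩
      exact ⟨fun i => fun k => (Finset.sum_le_sum fun l _ => (h1 i).1 k l).trans ((h1 i).2 k),
        fun i => fun k => (Finset.sum_le_sum fun l _ => (h2 i).1 k l).trans ((h2 i).2 k), fun k => (Finset.sum_le_sum fun l _ => h3.1 k l).trans (h3.2 k)⟩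
    · rintro ⟨h1, h2, h3⟩
      exact ⟨⟨fun i => (Z.P i).map abs, fun i => (Z.Q i).map abs, Z.P0.map abs⟩,
        fun i => ⟨fun k l => le_rfl, h1 i⟩, fun i => ⟨fun k l => le_rfl, h2 i⟩,
        fun k l => le_rfl, h3⟩

/-! Fix $(x,U)$. If $U_i=0$ whenever $x_i=0$ and $x-U_i=0$ whenever $x_i=1$, then $g_3(x,U,\cdot)$
is linear in $Z$, with matrix coefficients $U_iU_i^T/x_i$, $(x-U_i)(x-U_i)^T/(1-x_i)$ and $xx^T$
(`g3_eq`). Its supremum over $\mathcal Z_2$ is then a linear program in $(Z,T,S,T')$, whose dual is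
the conic program with $Y^i,R^i,Y^{n+1}$ frozen at these rank-one matrices. By the Schur complement
(`borderedMatrix_posSemidef_iff`) the conic constraints only ask that the matrices dominate the
rank-one ones. This relaxation does not lower the optimum: symmetric diagonally dominant matrices
pair nonnegatively with positive semidefinite ones (`matInner_nonneg_of_isDiagDominant`), so weak
duality survives (`g3_le_conicObj`). Strong duality with attainment is thus inherited from linear
programming (`linearProgram_duality`), and no Slater condition is needed.

The value $+\infty$ rests on `exists_slcCoeffs_isDiagDominant`: every cubic has a diagonally
dominant decomposition. The linear program is therefore always feasible, and it is unbounded if its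
dual is infeasible. Where some vector over a zero denominator is nonzero, the margin in the
decomposition makes $g_3$ infinite at a single $Z$, while the semidefinite constraints fail. The
min-max statements follow by merging two infima and using attainment in the inner one. -/

/-! ### Linear programming duality from Farkas' lemma -/

section LinearProgramming

variable {V : Type*} [AddCommGroup V] [Module ℝ V]

/-- Farkas' lemma, for the functionals indexed by a finset. -/
theorem farkas_finset {κ : Type*} (s : Finset κ) (a : κ → V →ₗ[ℝ] ℝ) (b : V →ₗ[ℝ] ℝ)
    (h : ∀ x, (∀ j ∈ s, 0 ≤ a j x) → 0 ≤ b x) :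
    ∃ θ : κ → ℝ, (∀ j, 0 ≤ θ j) ∧ b = ∑ j ∈ s, θ j • a j := by
  classical
  induction s using Finset.induction_on generalizing a b with
  | empty =>
    refine ⟨0, fun _ => le_rfl, LinearMap.ext fun x => ?_⟩
    have h1 := h x (by simp)
    have h2 := h (-x) (by simp)
    rw [map_neg] at h2
    simp only [Finset.sum_empty, LinearMap.zero_apply]
    linarith
  | insert k s hk ih =>
    by_cases hs : ∀ x, (∀ j ∈ s, 0 ≤ a j x) → 0 ≤ b x
    · obtain ⟨θ, hθ, hb⟩ := ih a b hs
      refine ⟨Function.update θ k 0, fun j => ?_, ?_⟩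
      · by_cases hj : j = k
        · subst hj; simp
        · simpa [hj] using hθ j
      · rw [Finset.sum_insert hk, Function.update_self, zero_smul, zero_add, hb]
        refine Finset.sum_congr rfl fun j hj => ?_
        rw [Function.update_of_ne (ne_of_mem_of_not_mem hj hk)]
    · push Not at hs
      obtain ⟨x, hx, hbx⟩ := hs
      have hax : a k x < 0 := by
        by_contra! hax
        exact absurd (h x (by simpa [hax] using hx)) (not_le.2 hbx)
      -- Normalized so that `a k v = -1`: then `y ↦ y + a k y • v` projects onto the kernel of `a
      -- k`.
      obtain ⟨v, hv⟩ : ∃ v, v = (-(a k x))⁻¹ • x := ⟨_, rfl⟩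
      have hpos : 0 < (-(a k x))⁻¹ := inv_pos.2 (neg_pos.2 hax)
      have hav : a k v = -1 := by
        rw [hv, map_smul, smul_eq_mul, inv_neg, neg_mul, inv_mul_cancel₀ hax.ne]
      have hsv : ∀ j ∈ s, 0 ≤ a j v := fun j hj => by
        rw [hv, map_smul, smul_eq_mul]
        exact mul_nonneg hpos.le (hx j hj)
      have hbv : b v ≤ 0 := by
        rw [hv, map_smul, smul_eq_mul]
        exact mul_nonpos_of_nonneg_of_nonpos hpos.le hbx.le
      -- The induction hypothesis is applied to the functionals composed with this projection, for
      -- which the constraint `k` is automatic.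
      obtain ⟨θ, hθ, hb⟩ := ih (fun j => a j + a j v • a k) (b + b v • a k) fun y hy => by
        have := h (y + a k y • v) fun j hj => by
          rcases Finset.mem_insert.1 hj with rfl | hj
          · simp [hav]
          · simpa [mul_comm] using hy j hj
        simpa [mul_comm] using this
      -- The multiplier of `a k` collects what the projection added; it is nonnegative because `a j
      -- v ≥ 0` on `s` and `b v ≤ 0`.
      refine ⟨Function.update θ k (∑ j ∈ s, θ j * a j v - b v), fun j => ?_, ?_⟩
      · by_cases hj : j = k
        · subst hj
          have := Finset.sum_nonneg fun i hi => mul_nonneg (hθ i) (hsv i hi)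
          simp only [Function.update_self]
          linarith
        · simpa [hj] using hθ j
      · have e : ∑ j ∈ s, Function.update θ k (∑ j ∈ s, θ j * a j v - b v) j • a j =
            ∑ j ∈ s, θ j • a j := Finset.sum_congr rfl fun j hj => by
          rw [Function.update_of_ne (ne_of_mem_of_not_mem hj hk)]
        rw [Finset.sum_insert hk, Function.update_self, e]
        refine LinearMap.ext fun y => ?_
        have := LinearMap.congr_fun hb y
        simp only [LinearMap.add_apply, LinearMap.smul_apply, smul_eq_mul, LinearMap.sum_apply,
          mul_add, Finset.sum_add_distrib, ← mul_assoc, ← Finset.sum_mul] at this ⊢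
        linarith

/-- The affine form of Farkas' lemma: a bound that a feasible system of linear inequalities implies
is a consequence by nonnegative multipliers. -/
theorem affine_farkas {κ : Type*} [Fintype κ] (a : κ → V →ₗ[ℝ] ℝ) (s : κ → ℝ) (c : V →ₗ[ℝ] ℝ)
    (B : ℝ) (x₀ : V) (hx₀ : ∀ j, a j x₀ ≤ s j) (h : ∀ x, (∀ j, a j x ≤ s j) → c x ≤ B) :
    ∃ θ : κ → ℝ, (∀ j, 0 ≤ θ j) ∧ c = ∑ j, θ j • a j ∧ ∑ j, θ j * s j ≤ B := by
  -- Homogenization by a scale variable $t$; the extra index `none` carries $t\ge0$, and its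
  -- multiplier is the slack in the final bound.
  let A : Option κ → V × ℝ →ₗ[ℝ] ℝ
    | none => LinearMap.snd ℝ V ℝ
    | some j => s j • LinearMap.snd ℝ V ℝ - a j ∘ₗ LinearMap.fst ℝ V ℝ
  obtain ⟨θ, hθ, hb⟩ := farkas_finset Finset.univ A
    (B • LinearMap.snd ℝ V ℝ - c ∘ₗ LinearMap.fst ℝ V ℝ) (by
      rintro ⟨x, t⟩ hx
      have ht : 0 ≤ t := hx none (Finset.mem_univ _)
      have hxj : ∀ j, a j x ≤ s j * t := fun j => by
        simpa [A] using hx (some j) (Finset.mem_univ _)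
      suffices c x ≤ B * t by simpa using this
      rcases ht.eq_or_lt with rfl | ht
      -- At $t=0$ the vector `x` is a recession direction. If `c x` were positive, a long step from
      -- `x₀` would break the bound `B`.
      · rw [mul_zero]
        by_contra! hc
        obtain ⟨k, hk⟩ := exists_nat_gt ((B - c x₀) / c x)
        have h1 := h (x₀ + (k : ℝ) • x) fun j => by
          have := mul_nonneg (Nat.cast_nonneg k : (0 : ℝ) ≤ k) (sub_nonneg.2 (hxj j))
          have := hx₀ j
          simp only [map_add, map_smul, smul_eq_mul]
          nlinarith
        rw [div_lt_iff₀ hc] at hk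
        simp only [map_add, map_smul, smul_eq_mul] at h1
        linarith
      · have h1 := h (t⁻¹ • x) fun j => by
          rw [map_smul, smul_eq_mul, inv_mul_le_iff₀ ht, mul_comm]
          exact hxj j
        rwa [map_smul, smul_eq_mul, inv_mul_le_iff₀ ht, mul_comm] at h1)
  rw [Fintype.sum_option] at hb
  refine ⟨fun j => θ (some j), fun j => hθ _, LinearMap.ext fun x => ?_, ?_⟩
  · have := LinearMap.congr_fun hb (x, 0)
    simpa [A] using this
  · have := LinearMap.congr_fun hb (0, 1)
    simp [A] at this
    have := hθ none
    linarith

/-- Gale's theorem of the alternative. -/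
theorem gale_alternative {κ : Type*} [Fintype κ] (a : κ → V →ₗ[ℝ] ℝ) (s : κ → ℝ)
    (h : ¬∃ x, ∀ j, a j x ≤ s j) :
    ∃ θ : κ → ℝ, (∀ j, 0 ≤ θ j) ∧ ∑ j, θ j • a j = 0 ∧ ∑ j, θ j * s j < 0 := by
  obtain ⟨θ, hθ, hb⟩ := farkas_finset Finset.univ
    (fun j => s j • LinearMap.snd ℝ V ℝ - a j ∘ₗ LinearMap.fst ℝ V ℝ)
    -- A solution of the homogenized system with $t>0$ would rescale to a solution of the original
    -- one, so $-t\ge0$ is implied.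
    (-LinearMap.snd ℝ V ℝ) (by
      rintro ⟨x, t⟩ hx
      by_contra! ht
      have ht : 0 < t := by simpa using ht
      refine h ⟨t⁻¹ • x, fun j => ?_⟩
      have := hx j (Finset.mem_univ _)
      rw [map_smul, smul_eq_mul, inv_mul_le_iff₀ ht, mul_comm]
      simpa using this)
  refine ⟨θ, hθ, LinearMap.ext fun x => ?_, ?_⟩
  · have := LinearMap.congr_fun hb (x, 0)
    simpa using this
  · have := LinearMap.congr_fun hb (0, 1)
    simp at this
    linarith

/-- A linear program that is feasible and bounded has an optimal solution. -/
theorem exists_isMaxOn_of_bounded {κ : Type*} [Fintype κ] (a : κ → V →ₗ[ℝ] ℝ) (s : κ → ℝ)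
    (c : V →ₗ[ℝ] ℝ) (B : ℝ) (x₀ : V) (hx₀ : ∀ j, a j x₀ ≤ s j)
    (h : ∀ x, (∀ j, a j x ≤ s j) → c x ≤ B) :
    ∃ z, (∀ j, a j z ≤ s j) ∧ ∀ x, (∀ j, a j x ≤ s j) → c x ≤ c z := by
  let S := c '' {x | ∀ j, a j x ≤ s j}
  have hne : S.Nonempty := ⟨_, x₀, hx₀, rfl⟩
  have hbdd : BddAbove S := ⟨B, by rintro _ ⟨x, hx, rfl⟩; exact h x hx⟩
  have hle : ∀ x, (∀ j, a j x ≤ s j) → c x ≤ sSup S := fun x hx => le_csSup hbdd ⟨x, hx, rfl⟩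
  -- Attainment means that the system stays solvable with the constraint that `c` reaches its
  -- supremum. A Gale certificate to the contrary would contradict feasibility (weight zero on the
  -- new constraint) or give an upper bound below the supremum (positive weight).
  suffices ∃ z, ∀ j : Option κ, (j.elim (-c) a : V →ₗ[ℝ] ℝ) z ≤ j.elim (-sSup S) s by
    obtain ⟨z, hz⟩ := this
    refine ⟨z, fun j => hz (some j), fun x hx => (hle x hx).trans ?_⟩
    simpa using hz none
  by_contra hno
  obtain ⟨θ, hθ, h1, h2⟩ := gale_alternative _ _ hno
  simp only [Fintype.sum_option, Option.elim_none, Option.elim_some] at h1 h2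
  have h3 : ∀ x, (∀ j, a j x ≤ s j) → θ none * c x ≤ ∑ j, θ (some j) * s j := fun x hx => by
    have h4 := LinearMap.congr_fun h1 x
    simp at h4
    have h5 : ∑ j, θ (some j) * a j x ≤ ∑ j, θ (some j) * s j :=
      Finset.sum_le_sum fun j _ => mul_le_mul_of_nonneg_left (hx j) (hθ _)
    linarith
  rcases (hθ none).eq_or_lt with h0 | h0
  · have := h3 x₀ hx₀
    rw [← h0] at this h2
    linarith
  · have h4 : sSup S ≤ (∑ j, θ (some j) * s j) / θ none := csSup_le hne (by
      rintro _ ⟨x, hx, rfl⟩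
      rw [le_div_iff₀ h0, mul_comm]
      exact h3 x hx)
    rw [le_div_iff₀ h0] at h4
    linarith

/-- Strong duality of linear programming, with attainment on both sides. -/
theorem linearProgram_duality {τ ι κ : Type*} [Fintype τ] [Fintype ι] [Fintype κ]
    (e : ι → τ → ℝ) (s : ι → ℝ) (a : κ → τ → ℝ) (t : κ → ℝ) (c : τ → ℝ) (B : ℝ)
    (hne : ∃ x, (∀ j, e j ⬝ᵥ x = s j) ∧ ∀ j, a j ⬝ᵥ x ≤ t j)
    (h : ∀ x, (∀ j, e j ⬝ᵥ x = s j) → (∀ j, a j ⬝ᵥ x ≤ t j) → c ⬝ᵥ x ≤ B) :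
    ∃ x, (∀ j, e j ⬝ᵥ x = s j) ∧ (∀ j, a j ⬝ᵥ x ≤ t j) ∧
      ∃ (l : ι → ℝ) (θ : κ → ℝ), (∀ j, 0 ≤ θ j) ∧
        c + ∑ j, l j • e j - ∑ j, θ j • a j = 0 ∧
        ∑ j, θ j * t j - ∑ j, l j * s j ≤ c ⬝ᵥ x := by
  classical
  let f : (τ → ℝ) → (τ → ℝ) →ₗ[ℝ] ℝ := fun v => dotProductBilin ℝ ℝ v
  have hf : ∀ v x, f v x = v ⬝ᵥ x := fun v x => rfl
  -- Each equation becomes two opposite inequalities; the free multiplier `l` is the difference of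
  -- their multipliers, with the sign convention of the conic program.
  let A : κ ⊕ ι ⊕ ι → (τ → ℝ) →ₗ[ℝ] ℝ :=
    Sum.elim (fun j => f (a j)) (Sum.elim (fun j => f (e j)) fun j => f (-e j))
  let b : κ ⊕ ι ⊕ ι → ℝ := Sum.elim t (Sum.elim s (-s))
  have hA : ∀ x, (∀ j, A j x ≤ b j) ↔ (∀ j, e j ⬝ᵥ x = s j) ∧ ∀ j, a j ⬝ᵥ x ≤ t j := by
    intro x
    simp only [Sum.forall, A, b, Sum.elim_inl, Sum.elim_inr, hf, neg_dotProduct, Pi.neg_apply,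
      neg_le_neg_iff]
    exact ⟨fun h => ⟨fun j => le_antisymm (h.2.1 j) (h.2.2 j), h.1⟩,
      fun h => ⟨h.2, fun j => (h.1 j).le, fun j => (h.1 j).ge⟩⟩
  obtain ⟨x₀, hx₀⟩ := hne
  obtain ⟨z, hz, hmax⟩ := exists_isMaxOn_of_bounded A b (f c) B x₀ ((hA x₀).2 hx₀)
    fun x hx => h x ((hA x).1 hx).1 ((hA x).1 hx).2
  obtain ⟨θ, hθ, h1, h2⟩ := affine_farkas A b (f c) (f c z) z hz hmax
  refine ⟨z, ((hA z).1 hz).1, ((hA z).1 hz).2,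
    fun j => θ (.inr (.inr j)) - θ (.inr (.inl j)), fun j => θ (.inl j), fun j => hθ _, ?_, ?_⟩
  · ext i
    have := LinearMap.congr_fun h1 (Pi.single i 1)
    simp only [Fintype.sum_sum_type, LinearMap.add_apply, LinearMap.sum_apply, LinearMap.smul_apply,
      A, Sum.elim_inl, Sum.elim_inr, hf, dotProduct_single, smul_eq_mul, mul_one, Pi.neg_apply,
      mul_neg, Finset.sum_neg_distrib] at this
    simp only [Pi.add_apply, Pi.sub_apply, Finset.sum_apply, Pi.smul_apply, smul_eq_mul, this,
      sub_mul, Finset.sum_sub_distrib, Pi.zero_apply]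
    ring
  · simp only [Fintype.sum_sum_type, b, Sum.elim_inl, Sum.elim_inr, Pi.neg_apply, mul_neg,
      Finset.sum_neg_distrib, hf] at h2
    simp only [sub_mul, Finset.sum_sub_distrib]
    linarith

end LinearProgramming

/-! ### Positive semidefinite and diagonally dominant matrices, Schur complements -/

section QuadraticForms

open Matrix

variable {n : ℕ}

theorem matInner_vecMulVec (u v : Fin n → ℝ) (M : Matrix (Fin n) (Fin n) ℝ) :
    matInner (vecMulVec u v) M = u ⬝ᵥ M *ᵥ v := by
  simp only [matInner, vecMulVec_apply, dotProduct, mulVec, Finset.mul_sum]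
  exact Finset.sum_congr rfl fun k _ => Finset.sum_congr rfl fun l _ => by ring

theorem matInner_sub (M N K : Matrix (Fin n) (Fin n) ℝ) :
    matInner (M - N) K = matInner M K - matInner N K := by
  rw [sub_eq_add_neg, matInner_add, matInner_neg, sub_eq_add_neg]

/-- Test the quadratic form on $e_k\pm e_l$. -/
theorem two_mul_abs_le_of_posSemidef {M : Matrix (Fin n) (Fin n) ℝ} (hM : M.PosSemidef)
    {k l : Fin n} : 2 * |M k l| ≤ M k k + M l l := by
  have h (a : ℝ) := hM.dotProduct_mulVec_nonneg (Pi.single k 1 + a • Pi.single l 1)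
  have hs : M l k = M k l := by simpa using hM.1.apply k l
  simp only [star_trivial, mulVec_add, mulVec_smul, add_dotProduct, dotProduct_add,
    smul_dotProduct, dotProduct_smul, single_one_dotProduct, mulVec_single_one, col_apply,
    smul_eq_mul, hs] at h
  have h1 := h 1
  have h2 := h (-1)
  have : |M k l| ≤ (M k k + M l l) / 2 := abs_le.2 ⟨by linarith, by linarith⟩
  linarith

/-- A symmetric diagonally dominant matrix has a nonnegative inner product with every positive
semidefinite matrix. -/
theorem matInner_nonneg_of_isDiagDominant {M P : Matrix (Fin n) (Fin n) ℝ} (hM : M.PosSemidef)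
    (hP : P.IsSymm) (hd : IsDiagDominant P) : 0 ≤ matInner M P := by
  -- Symmetry of `P` moves both halves of the bound $|M_{kl}|\le(M_{kk}+M_{ll})/2$ to row $k$, where
  -- dominance of that row applies.
  have hsymm : ∑ k, ∑ l ∈ Finset.univ.erase k, M l l * |P k l| =
      ∑ k, ∑ l ∈ Finset.univ.erase k, M k k * |P k l| := by
    rw [Finset.sum_comm' (t' := Finset.univ) (s' := fun l => Finset.univ.erase l)
      (by simp [eq_comm])]
    exact Finset.sum_congr rfl fun k _ => Finset.sum_congr rfl fun l _ => by rw [hP.apply k l]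
  have hoff : -∑ k, ∑ l ∈ Finset.univ.erase k, M k l * P k l ≤
      ∑ k, ∑ l ∈ Finset.univ.erase k, M k k * |P k l| := by
    have h1 : -∑ k, ∑ l ∈ Finset.univ.erase k, M k l * P k l ≤
        ∑ k, ∑ l ∈ Finset.univ.erase k, (M k k * |P k l| / 2 + M l l * |P k l| / 2) := by
      rw [← Finset.sum_neg_distrib]
      refine Finset.sum_le_sum fun k _ => ?_
      rw [← Finset.sum_neg_distrib]
      refine Finset.sum_le_sum fun l _ => ?_
      have h2 := two_mul_abs_le_of_posSemidef hM (k := k) (l := l)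
      have h3 : -(M k l * P k l) ≤ |M k l| * |P k l| := by
        rw [← abs_mul]
        exact neg_le_abs _
      nlinarith [abs_nonneg (P k l)]
    simp only [Finset.sum_add_distrib, ← Finset.sum_div, hsymm] at h1
    linarith
  have hdiag : ∑ k, ∑ l ∈ Finset.univ.erase k, M k k * |P k l| ≤ ∑ k, M k k * P k k := by
    refine Finset.sum_le_sum fun k _ => ?_
    rw [← Finset.mul_sum]
    exact mul_le_mul_of_nonneg_left (hd k) hM.diag_nonneg
  have : matInner M P = ∑ k, M k k * P k k + ∑ k, ∑ l ∈ Finset.univ.erase k, M k l * P k l := by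
    rw [matInner, ← Finset.sum_add_distrib]
    exact Finset.sum_congr rfl fun k _ =>
      (Finset.add_sum_erase _ (fun l => M k l * P k l) (Finset.mem_univ k)).symm
  linarith

/-- The matrix `u uᵀ / t`, with the value `0` at `t = 0`. -/
noncomputable def perspMatrix (u : Fin n → ℝ) (t : ℝ) : Matrix (Fin n) (Fin n) ℝ :=
  t⁻¹ • vecMulVec u u

theorem matInner_perspMatrix (u : Fin n → ℝ) (t : ℝ) (M : Matrix (Fin n) (Fin n) ℝ) :
    matInner (perspMatrix u t) M = u ⬝ᵥ M *ᵥ u / t := by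
  rw [perspMatrix, matInner_smul, matInner_vecMulVec, inv_mul_eq_div]

theorem perspMatrix_isSymm (u : Fin n → ℝ) (t : ℝ) : (perspMatrix u t).IsSymm := by
  ext k l
  simp [perspMatrix, vecMulVec_apply, mul_comm]

/-- At $t=0$ the hypothesis leaves only $u=0$, where the closure of the perspective agrees with the
convention `0⁻¹ = 0` in `perspMatrix`. -/
theorem quadOverLin_eq (M : Matrix (Fin n) (Fin n) ℝ) {u : Fin n → ℝ} {t : ℝ}
    (h : t = 0 → u = 0) : quadOverLin M u t = (matInner (perspMatrix u t) M : ℝ) := by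
  rw [matInner_perspMatrix, quadOverLin]
  split_ifs with h0 h1
  · simp [h0]
  · simp [h h0] at h1
  · rfl

theorem quadOverLin_ne_bot (M : Matrix (Fin n) (Fin n) ℝ) (u : Fin n → ℝ) (t : ℝ) :
    quadOverLin M u t ≠ ⊥ := by
  rw [quadOverLin]
  split_ifs <;> simp [EReal.coe_ne_bot]

theorem borderedMatrix_quadForm (Y : Matrix (Fin n) (Fin n) ℝ) (u v : Fin n → ℝ) (t s : ℝ) :
    Sum.elim v (fun _ => s) ⬝ᵥ borderedMatrix Y u t *ᵥ Sum.elim v (fun _ : Unit => s) =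
      v ⬝ᵥ Y *ᵥ v + 2 * s * (u ⬝ᵥ v) + t * s ^ 2 := by
  simp only [borderedMatrix, fromBlocks_mulVec, Function.comp_def, Sum.elim_inl, Sum.elim_inr,
    sumElim_dotProduct_sumElim, dotProduct_add]
  have h1 : v ⬝ᵥ (of fun k (_ : Unit) => u k) *ᵥ (fun _ => s) = s * (u ⬝ᵥ v) := by
    simp only [dotProduct, mulVec, of_apply, Finset.univ_unique, Finset.sum_singleton,
      Finset.mul_sum]
    exact Finset.sum_congr rfl fun k _ => by ring
  have h2 : (fun _ : Unit => s) ⬝ᵥ (of fun (_ : Unit) k => u k) *ᵥ v = s * (u ⬝ᵥ v) := by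
    simp [dotProduct, mulVec]
  have h3 : (fun _ : Unit => s) ⬝ᵥ (of fun (_ _ : Unit) => t) *ᵥ (fun _ => s) = t * s ^ 2 := by
    simp [dotProduct, mulVec]
    ring
  rw [h1, h2, h3]
  ring

theorem perspMatrix_quadForm (u v : Fin n → ℝ) (t : ℝ) :
    v ⬝ᵥ perspMatrix u t *ᵥ v = t⁻¹ * (u ⬝ᵥ v) ^ 2 := by
  rw [perspMatrix, smul_mulVec, dotProduct_smul, vecMulVec_mulVec, smul_eq_mul]
  simp [dotProduct_smul, dotProduct_comm v u]
  exact Or.inl (by ring)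

/-- The Schur complement criterion for `[[Y, u], [uᵀ, t]]`, including the case `t = 0`. -/
theorem borderedMatrix_posSemidef_iff {Y : Matrix (Fin n) (Fin n) ℝ} {u : Fin n → ℝ} {t : ℝ}
    (ht : 0 ≤ t) :
    (borderedMatrix Y u t).PosSemidef ↔
      (t = 0 → u = 0) ∧ (Y - perspMatrix u t).PosSemidef := by
  have hq : ∀ v, v ⬝ᵥ (Y - perspMatrix u t) *ᵥ v = v ⬝ᵥ Y *ᵥ v - t⁻¹ * (u ⬝ᵥ v) ^ 2 := fun v => by
    rw [sub_mulVec, dotProduct_sub, perspMatrix_quadForm]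
  constructor
  · intro h
    have h1 : ∀ v s, 0 ≤ v ⬝ᵥ Y *ᵥ v + 2 * s * (u ⬝ᵥ v) + t * s ^ 2 := fun v s => by
      rw [← borderedMatrix_quadForm]
      simpa using h.dotProduct_mulVec_nonneg (Sum.elim v fun _ => s)
    constructor
    · rintro rfl
      by_contra hu
      have hpos : u ⬝ᵥ u ≠ 0 := fun h0 => hu (dotProduct_self_eq_zero.1 h0)
      -- With $t=0$ the form is affine in $s$; this $s$ gives it the value $-1$.
      have h2 := h1 u (-(u ⬝ᵥ Y *ᵥ u + 1) / (2 * (u ⬝ᵥ u)))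
      have h3 : 2 * (-(u ⬝ᵥ Y *ᵥ u + 1) / (2 * (u ⬝ᵥ u))) * (u ⬝ᵥ u) = -(u ⬝ᵥ Y *ᵥ u + 1) := by
        field_simp
      rw [h3] at h2
      linarith
    · refine PosSemidef.of_dotProduct_mulVec_nonneg (IsHermitian.sub ?_ ?_) fun v => ?_
      · ext k l
        simpa [borderedMatrix] using h.1.apply (Sum.inl k) (Sum.inl l)
      · exact (perspMatrix_isSymm u t)
      · rw [star_trivial, hq]
        -- The minimizer in $s$ when $t>0$; for $t=0$ it is $0$, since `0⁻¹ = 0`.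
        have h2 := h1 v (-(t⁻¹ * (u ⬝ᵥ v)))
        rcases ht.eq_or_lt with rfl | ht
        · simpa using h2
        · refine h2.trans_eq ?_
          linear_combination (t⁻¹ * (u ⬝ᵥ v) ^ 2) * mul_inv_cancel₀ ht.ne'
  · rintro ⟨h0, h⟩
    refine PosSemidef.of_dotProduct_mulVec_nonneg ?_ fun z => ?_
    · have hY : Y.IsHermitian := by
        have := h.1.add (B := perspMatrix u t) (perspMatrix_isSymm u t)
        rwa [sub_add_cancel] at this
      ext k l
      rcases k with k | k <;> rcases l with l | l <;> simp [borderedMatrix]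
      simpa using hY.apply k l
    · have hz : z = Sum.elim (fun k => z (.inl k)) fun _ => z (.inr ()) := by
        ext (k | k) <;> rfl
      rw [star_trivial, hz, borderedMatrix_quadForm]
      generalize (fun k => z (.inl k)) = v
      generalize z (.inr ()) = s
      have h1 := h.dotProduct_mulVec_nonneg v
      rw [star_trivial, hq] at h1
      rcases ht.eq_or_lt with rfl | ht
      · simpa [h0 rfl] using h1
      · have : v ⬝ᵥ Y *ᵥ v + 2 * s * (u ⬝ᵥ v) + t * s ^ 2 =
            (v ⬝ᵥ Y *ᵥ v - t⁻¹ * (u ⬝ᵥ v) ^ 2) + t * (s + t⁻¹ * (u ⬝ᵥ v)) ^ 2 := by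
          field_simp
          ring
        rw [this]
        positivity

end QuadraticForms

/-! ### Diagonally dominant decompositions of cubic polynomials -/

section Decomposition

variable {n : ℕ}

theorem quadPoly_add (M M' : Matrix (Fin n) (Fin n) ℝ) (b b' : Fin n → ℝ) (c c' : ℝ) :
    quadPoly (M + M') (b + b') (c + c') = quadPoly M b c + quadPoly M' b' c' := by
  simp only [quadPoly, Matrix.add_apply, Pi.add_apply, C_add, add_mul, Finset.sum_add_distrib]
  ring

theorem quadPoly_zero : quadPoly (0 : Matrix (Fin n) (Fin n) ℝ) 0 0 = 0 := by
  simp [quadPoly]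

theorem quadPoly_smul_one (a : ℝ) :
    quadPoly (a • (1 : Matrix (Fin n) (Fin n) ℝ)) 0 0 = C a * ∑ k, X k * X k := by
  simp only [quadPoly, Matrix.smul_apply, Matrix.one_apply, smul_eq_mul, mul_ite, mul_one, mul_zero,
    Pi.zero_apply, C_0, zero_mul, Finset.sum_const_zero, add_zero, Finset.mul_sum]
  refine Finset.sum_congr rfl fun k _ => ?_
  rw [Finset.sum_eq_single k (fun l _ h => by simp [h.symm]) (by simp)]
  simp

/-- `q` is a quadratic polynomial with a symmetric matrix. -/
def IsQuadratic (q : MvPolynomial (Fin n) ℝ) : Prop :=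
  ∃ M b c, M.IsSymm ∧ quadPoly M b c = q

theorem exists_eq_single_add {e : Fin n →₀ ℕ} (he : e ≠ 0) :
    ∃ (i : Fin n) (e' : Fin n →₀ ℕ), e = Finsupp.single i 1 + e' := by
  obtain ⟨i, hi⟩ := Finsupp.ne_iff.1 he
  refine ⟨i, e - Finsupp.single i 1, (add_tsub_cancel_of_le ?_).symm⟩
  rw [Finsupp.single_le_iff]
  exact Nat.one_le_iff_ne_zero.2 hi

theorem isQuadratic_monomial {e : Fin n →₀ ℕ} (he : e.degree ≤ 2) (a : ℝ) :
    IsQuadratic (monomial e a) := by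
  classical
  by_cases h0 : e = 0
  · subst h0
    exact ⟨0, 0, a, Matrix.isSymm_zero, by simp [quadPoly]⟩
  obtain ⟨i, e, rfl⟩ := exists_eq_single_add h0
  by_cases h1 : e = 0
  · subst h1
    refine ⟨0, Pi.single i a, 0, Matrix.isSymm_zero, ?_⟩
    simp only [quadPoly, Matrix.zero_apply, C_0, zero_mul, Finset.sum_const_zero, zero_add,
      add_zero]
    rw [Finset.sum_eq_single i (fun k _ h => by simp [h]) (by simp), Pi.single_eq_same,
      C_mul_X_eq_monomial]
  obtain ⟨j, e, rfl⟩ := exists_eq_single_add h1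
  have h2 : e = 0 := by
    rw [map_add, map_add, Finsupp.degree_single, Finsupp.degree_single] at he
    exact (Finsupp.degree_eq_zero_iff e).1 (by omega)
  subst h2
  -- The coefficient is split evenly for symmetry; if $i=j$ the two halves add up on the diagonal.
  refine ⟨(a / 2) • (.single i j 1 + .single j i 1), 0, 0,
    Matrix.IsSymm.smul (by simp [Matrix.IsSymm, add_comm]) _, ?_⟩
  have hs : ∀ i j : Fin n, ∑ k, ∑ l, C (Matrix.single i j (a / 2) k l) * (X k * X l) =
      (C (a / 2) * (X i * X j) : MvPolynomial (Fin n) ℝ) := fun i j => by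
    rw [Finset.sum_eq_single i (fun k _ h => Finset.sum_eq_zero fun l _ => by
        simp [h.symm]) (by simp),
      Finset.sum_eq_single j (fun k _ h => by simp [h.symm]) (by simp)]
    simp
  have hm : (monomial (Finsupp.single i 1 + (Finsupp.single j 1 + 0)) a : MvPolynomial (Fin n) ℝ) =
      C a * (X i * X j) := by
    rw [add_zero, X, X, monomial_mul, C_mul_monomial, one_mul, mul_one]
  have ha : (C a : MvPolynomial (Fin n) ℝ) = C (a / 2) + C (a / 2) := by rw [← C_add, add_halves]
  rw [hm]
  simp only [quadPoly, smul_add, Matrix.smul_single, smul_eq_mul, mul_one, Matrix.add_apply, C_add,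
    add_mul, Finset.sum_add_distrib, hs, Pi.zero_apply, C_0, zero_mul, Finset.sum_const_zero,
    add_zero, ha]
  ring

/-- `q = ∑ x_i q_i + c` with quadratic polynomials `q_i`. -/
def IsSumMulQuadratic (q : MvPolynomial (Fin n) ℝ) : Prop :=
  ∃ (P : Fin n → Matrix (Fin n) (Fin n) ℝ) (r : Fin n → Fin n → ℝ) (w : Fin n → ℝ) (c : ℝ),
    (∀ i, (P i).IsSymm) ∧ (∑ i, X i * quadPoly (P i) (r i) (w i)) + C c = q

theorem IsSumMulQuadratic.add {q q' : MvPolynomial (Fin n) ℝ} (h : IsSumMulQuadratic q)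
    (h' : IsSumMulQuadratic q') : IsSumMulQuadratic (q + q') := by
  obtain ⟨P, r, w, c, hP, rfl⟩ := h
  obtain ⟨P', r', w', c', hP', rfl⟩ := h'
  refine ⟨P + P', r + r', w + w', c + c', fun i => (hP i).add (hP' i), ?_⟩
  simp only [Pi.add_apply, quadPoly_add, mul_add, Finset.sum_add_distrib, C_add]
  ring

theorem isSumMulQuadratic_C (c : ℝ) : IsSumMulQuadratic (C c : MvPolynomial (Fin n) ℝ) :=
  ⟨0, 0, 0, c, fun _ => Matrix.isSymm_zero, by simp [quadPoly_zero]⟩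

/-- Each nonconstant monomial gives up one variable, and what remains has degree at most $2$. -/
theorem isSumMulQuadratic_of_totalDegree_le (p : MvPolynomial (Fin n) ℝ)
    (hp : p.totalDegree ≤ 3) : IsSumMulQuadratic p := by
  rw [p.as_sum]
  refine Finset.sum_induction _ _ (fun _ _ => IsSumMulQuadratic.add)
    (by simpa using isSumMulQuadratic_C (n := n) 0) fun e he => ?_
  have hdeg : e.degree ≤ 3 := (le_totalDegree he).trans hp
  by_cases h0 : e = 0
  · rw [h0]
    exact isSumMulQuadratic_C _
  obtain ⟨i, e', he'⟩ := exists_eq_single_add h0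
  rw [he', map_add, Finsupp.degree_single] at hdeg
  obtain ⟨M, b, c, hM, hq⟩ := isQuadratic_monomial (e := e') (by omega) (coeff e p)
  refine ⟨Pi.single i M, Pi.single i b, Pi.single i c, 0, fun k => ?_, ?_⟩
  · by_cases hk : k = i
    · subst hk
      simpa using hM
    · simp [hk]
  · rw [Finset.sum_eq_single i (fun k _ hk => by simp [hk, quadPoly_zero]) (by simp)]
    simp only [Pi.single_eq_same, hq, C_0, add_zero]
    rw [X, monomial_mul, one_mul, ← he']

/-- The shift leaves the off-diagonal entries alone, so the sum of all $|M_{kl}|$ serves as `K`. -/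
theorem exists_isDiagDominant_add_smul_one (M : Matrix (Fin n) (Fin n) ℝ) :
    ∃ K : ℝ, ∀ a, K ≤ a → IsDiagDominant (M + a • (1 : Matrix (Fin n) (Fin n) ℝ)) := by
  refine ⟨∑ k, ∑ l, |M k l|, fun a ha k => ?_⟩
  have h1 : ∑ l ∈ Finset.univ.erase k, |(M + a • (1 : Matrix (Fin n) (Fin n) ℝ)) k l| =
      ∑ l ∈ Finset.univ.erase k, |M k l| :=
    Finset.sum_congr rfl fun l hl => by
      simp [(Finset.ne_of_mem_erase hl).symm]
  have h2 : ∑ l, |M k l| ≤ ∑ k, ∑ l, |M k l| :=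
    Finset.single_le_sum (f := fun k => ∑ l, |M k l|)
      (fun _ _ => Finset.sum_nonneg fun _ _ => abs_nonneg _) (Finset.mem_univ k)
  rw [← Finset.add_sum_erase _ _ (Finset.mem_univ k)] at h2
  have h3 := neg_abs_le (M k k)
  rw [h1, Matrix.add_apply, Matrix.smul_apply, Matrix.one_apply_eq, smul_eq_mul, mul_one]
  linarith

/-- Every cubic polynomial has an SLC decomposition in which the matrices of the quadratics are
diagonally dominant, with a margin in the matrices `P^i` and `Q^i`. -/
theorem exists_slcCoeffs_isDiagDominant (p : MvPolynomial (Fin n) ℝ) (hp : p.totalDegree ≤ 3) :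
    ∃ Z : SLCCoeffs n, Z.IsSymm ∧ Z.toPoly = p ∧ Z.IsDiagDominant ∧
      (∀ i, _root_.IsDiagDominant (Z.P i - 1)) ∧ ∀ i, _root_.IsDiagDominant (Z.Q i - 1) := by
  obtain ⟨P, r, w, c, hP, hp⟩ := isSumMulQuadratic_of_totalDegree_le p hp
  choose K hK using fun i => exists_isDiagDominant_add_smul_one (P i)
  obtain ⟨K0, hK0⟩ := exists_isDiagDominant_add_smul_one (0 : Matrix (Fin n) (Fin n) ℝ)
  obtain ⟨a, ha0, ha⟩ : ∃ a, K0 + 1 ≤ a ∧ ∀ i, K i + 1 ≤ a := by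
    obtain ⟨b, hb⟩ := (Set.finite_range fun i => K i + 1).bddAbove
    exact ⟨max (K0 + 1) b, le_max_left _ _, fun i => le_max_of_le_right (hb ⟨i, rfl⟩)⟩
  have hQ : ∀ b, K0 ≤ b → _root_.IsDiagDominant (b • (1 : Matrix (Fin n) (Fin n) ℝ)) := fun b hb => by
    simpa using hK0 b hb
  have e1 : ∀ M : Matrix (Fin n) (Fin n) ℝ, M + a • 1 - 1 = M + (a - 1) • 1 := fun M => by
    rw [sub_smul, one_smul, add_sub_assoc]
  -- Adding $aI$ to every $P^i$ and $Q^i$ adds $a\sum_i(x_i+1-x_i)\|x\|^2=an\|x\|^2$. The linear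
  -- terms $-an\,x_i$, multiplied by $x_i$, cancel this. The $+1$ in the bounds on `a` is the
  -- margin.
  refine ⟨⟨fun i => P i + a • 1, fun _ => a • 1, 0, fun i => r i + Pi.single i (-(a * n)), 0, 0,
    fun i => w i + 0, 0, c⟩, ⟨fun i => ?_, fun i => ?_, Matrix.isSymm_zero⟩, ?_,
    ⟨fun i => hK i a (by linarith [ha i]), fun i => hQ a (by linarith),
      fun k => by simp⟩, fun i => ?_, fun i => ?_⟩
  · exact (hP i).add (Matrix.isSymm_one.smul _)
  · exact Matrix.isSymm_one.smul _
  · have h1 : ∀ i, quadPoly (P i + a • 1) (r i + Pi.single i (-(a * n))) (w i + 0) =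
        quadPoly (P i) (r i) (w i) + C a * ∑ k, X k * X k + C (-(a * n)) * X i := fun i => by
      have h2 : quadPoly (0 : Matrix (Fin n) (Fin n) ℝ) (Pi.single i (-(a * n))) 0 =
          C (-(a * n)) * X i := by
        simp only [quadPoly, Matrix.zero_apply, C_0, zero_mul, Finset.sum_const_zero, zero_add,
          add_zero]
        rw [Finset.sum_eq_single i (fun k _ h => by simp [h]) (by simp), Pi.single_eq_same]
      rw [← quadPoly_smul_one, ← h2, ← quadPoly_add, ← quadPoly_add]
      simp
    have h3 : quadPoly (0 : Matrix (Fin n) (Fin n) ℝ) 0 c = C c := by simp [quadPoly]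
    rw [← hp]
    simp only [SLCCoeffs.toPoly, h1, h3, Pi.zero_apply, quadPoly_smul_one, mul_add, sub_mul,
      Finset.sum_add_distrib, Finset.sum_sub_distrib, one_mul, Finset.sum_const, Finset.card_univ,
      Fintype.card_fin, nsmul_eq_mul]
    have h4 : ∑ i : Fin n, X i * (C (-(a * n)) * X i) =
        -((n : MvPolynomial (Fin n) ℝ) * (C a * ∑ k : Fin n, X k * X k)) := by
      rw [Finset.mul_sum, Finset.mul_sum, ← Finset.sum_neg_distrib]
      refine Finset.sum_congr rfl fun i _ => ?_
      rw [C_neg, C_mul, C_eq_coe_nat]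
      ring
    rw [h4]
    ring
  · rw [e1]
    exact hK i _ (by linarith [ha i])
  · have := hQ (a - 1) (by linarith)
    rwa [sub_smul, one_smul] at this

end Decomposition

/-! ### The linear program in coordinates -/

section ConicDuality

variable {n : ℕ} {ι κ : Type*}

/-- The index set of the scalar unknowns in `(Z, T, S, T')`. -/
abbrev UnknownIndex (n : ℕ) : Type :=
  (Fin n × Fin n × Fin n) ⊕ (Fin n × Fin n × Fin n) ⊕ (Fin n × Fin n) ⊕ (Fin n × Fin n) ⊕
    (Fin n × Fin n) ⊕ Fin n ⊕ Fin n ⊕ Fin n ⊕ Unit ⊕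
    (Fin n × Fin n × Fin n) ⊕ (Fin n × Fin n × Fin n) ⊕ (Fin n × Fin n)

/-- The coefficient vector of a linear form in the unknowns `(Z, T, S, T')`. -/
def LinRow.toVec (a : LinRow n) (H G : Fin n → Matrix (Fin n) (Fin n) ℝ)
    (Psi : Matrix (Fin n) (Fin n) ℝ) : UnknownIndex n → ℝ :=
  Sum.elim (fun q => a.A q.1 q.2.1 q.2.2) <| Sum.elim (fun q => a.B q.1 q.2.1 q.2.2) <|
  Sum.elim (fun q => a.Xi q.1 q.2) <| Sum.elim (fun q => a.c q.1 q.2) <|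
  Sum.elim (fun q => a.d q.1 q.2) <| Sum.elim a.omega <| Sum.elim a.mu <| Sum.elim a.nu <|
  Sum.elim (fun _ => a.gamma) <| Sum.elim (fun q => H q.1 q.2.1 q.2.2) <|
  Sum.elim (fun q => G q.1 q.2.1 q.2.2) fun q => Psi q.1 q.2

/-- The vector of the unknowns `(Z, T, S, T')`. -/
def SLCCoeffs.toVec (Z : SLCCoeffs n) (t : AuxVars n) : UnknownIndex n → ℝ :=
  LinRow.toVec ⟨Z.P, Z.Q, Z.P0, Z.r, Z.f, Z.r0, Z.w, Z.g, Z.w0⟩ t.T t.S t.T0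

theorem exists_toVec_eq (x : UnknownIndex n → ℝ) : ∃ (Z : SLCCoeffs n) (t : AuxVars n),
    Z.toVec t = x := by
  refine ⟨⟨fun i k l => x (.inl (i, k, l)), fun i k l => x (.inr (.inl (i, k, l))),
    fun k l => x (.inr (.inr (.inl (k, l)))), fun i k => x (.inr (.inr (.inr (.inl (i, k))))),
    fun i k => x (.inr (.inr (.inr (.inr (.inl (i, k)))))),
    fun k => x (.inr (.inr (.inr (.inr (.inr (.inl k)))))),
    fun i => x (.inr (.inr (.inr (.inr (.inr (.inr (.inl i))))))),
    fun i => x (.inr (.inr (.inr (.inr (.inr (.inr (.inr (.inl i)))))))),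
    x (.inr (.inr (.inr (.inr (.inr (.inr (.inr (.inr (.inl ())))))))))⟩,
    ⟨fun i k l => x (.inr (.inr (.inr (.inr (.inr (.inr (.inr (.inr (.inr (.inl (i, k, l))))))))))),
    fun i k l =>
      x (.inr (.inr (.inr (.inr (.inr (.inr (.inr (.inr (.inr (.inr (.inl (i, k, l)))))))))))),
    fun k l =>
      x (.inr (.inr (.inr (.inr (.inr (.inr (.inr (.inr (.inr (.inr (.inr (k, l))))))))))))⟩, ?_⟩
  ext j
  rcases j with _ | _ | _ | _ | _ | _ | _ | _ | _ | _ | _ | _ <;> rfl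

theorem toVec_dotProduct_toVec (a : LinRow n) (H G : Fin n → Matrix (Fin n) (Fin n) ℝ)
    (Psi : Matrix (Fin n) (Fin n) ℝ) (Z : SLCCoeffs n) (t : AuxVars n) :
    a.toVec H G Psi ⬝ᵥ Z.toVec t =
      a.eval Z + (∑ i, (matInner (H i) (t.T i) + matInner (G i) (t.S i))) +
        matInner Psi t.T0 := by
  simp only [dotProduct, Fintype.sum_sum_type, Fintype.sum_prod_type, LinRow.toVec, SLCCoeffs.toVec,
    Sum.elim_inl, Sum.elim_inr, LinRow.eval, matInner, Finset.sum_add_distrib,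
    Finset.univ_unique, Finset.sum_singleton]
  ring

theorem toVec_dotProduct_toVec_zero (a : LinRow n) (Z : SLCCoeffs n) (t : AuxVars n) :
    a.toVec 0 0 0 ⬝ᵥ Z.toVec t = a.eval Z := by
  simp [toVec_dotProduct_toVec, matInner_zero]

/-- The linear form in `Z` with the matrix coefficients `Y^i`, `R^i`, `Y^{n+1}` of the conic program
at the point `(x, U)`. -/
def conicRow (x : Fin n → ℝ) (U : Matrix (Fin n) (Fin n) ℝ) (Y R : Fin n → Matrix (Fin n) (Fin n) ℝ)
    (Y0 : Matrix (Fin n) (Fin n) ℝ) : LinRow n where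
  A := Y
  B := R
  Xi := Y0
  c := fun i => U i
  d := fun i => x - U i
  omega := x
  mu := x
  nu := fun i => 1 - x i
  gamma := 1

/-- The equality constraints, read block by block, are the stationarity condition of the linear
program. The auxiliary blocks of the objective are zero, whence the constraints on $H,G,\Psi$. -/
theorem ConicFeasible.vec_eq [Fintype ι] [Fintype κ] {E : EqSystem n ι} {I : IneqSystem n κ}
    {x : Fin n → ℝ} {U : Matrix (Fin n) (Fin n) ℝ} {v : ConicVars n ι κ}
    (h : ConicFeasible E I x U v) :
    (conicRow x U v.Y v.R v.Y0).toVec 0 0 0 + ∑ j, v.lam j • (E.row j).toVec 0 0 0 -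
      ∑ j, v.theta j • (I.row j).toVec (I.H j) (I.G j) (I.Psi j) = 0 := by
  ext j
  rcases j with ⟨i, k, l⟩ | ⟨i, k, l⟩ | ⟨k, l⟩ | ⟨i, k⟩ | ⟨i, k⟩ | k | i | i | _ | ⟨i, k, l⟩ |
    ⟨i, k, l⟩ | ⟨k, l⟩
  · simpa [LinRow.toVec, conicRow, Matrix.sum_apply] using congrFun₂ (h.eqP i) k l
  · simpa [LinRow.toVec, conicRow, Matrix.sum_apply] using congrFun₂ (h.eqQ i) k l
  · simpa [LinRow.toVec, conicRow, Matrix.sum_apply] using congrFun₂ h.eqP0 k l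
  · simpa [LinRow.toVec, conicRow] using congrFun (h.eqr i) k
  · simpa [LinRow.toVec, conicRow] using congrFun (h.eqf i) k
  · simpa [LinRow.toVec, conicRow] using congrFun h.eqr0 k
  · simpa [LinRow.toVec, conicRow] using h.eqw i
  · simpa [LinRow.toVec, conicRow] using h.eqg i
  · simpa [LinRow.toVec, conicRow] using h.eqw0
  · simpa [LinRow.toVec, conicRow, Matrix.sum_apply] using congrFun₂ (h.eqT i) k l
  · simpa [LinRow.toVec, conicRow, Matrix.sum_apply] using congrFun₂ (h.eqS i) k l
  · simpa [LinRow.toVec, conicRow, Matrix.sum_apply] using congrFun₂ h.eqT0 k l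

theorem conicFeasible_of_vec_eq [Fintype ι] [Fintype κ] {E : EqSystem n ι} {I : IneqSystem n κ}
    {x : Fin n → ℝ} {U : Matrix (Fin n) (Fin n) ℝ} {v : ConicVars n ι κ}
    (h : (conicRow x U v.Y v.R v.Y0).toVec 0 0 0 + ∑ j, v.lam j • (E.row j).toVec 0 0 0 -
      ∑ j, v.theta j • (I.row j).toVec (I.H j) (I.G j) (I.Psi j) = 0)
    (lmiP : ∀ i, (borderedMatrix (v.Y i) (U i) (x i)).PosSemidef)
    (lmiQ : ∀ i, (borderedMatrix (v.R i) (x - U i) (1 - x i)).PosSemidef)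
    (lmiP0 : (borderedMatrix v.Y0 x 1).PosSemidef) (theta_nonneg : ∀ j, 0 ≤ v.theta j) :
    ConicFeasible E I x U v where
  lmiP := lmiP
  lmiQ := lmiQ
  lmiP0 := lmiP0
  theta_nonneg := theta_nonneg
  eqP i := by
    ext k l
    simpa [LinRow.toVec, conicRow, Matrix.sum_apply] using congrFun h (.inl (i, k, l))
  eqQ i := by
    ext k l
    simpa [LinRow.toVec, conicRow, Matrix.sum_apply] using congrFun h (.inr (.inl (i, k, l)))
  eqP0 := by
    ext k l
    simpa [LinRow.toVec, conicRow, Matrix.sum_apply] using congrFun h (.inr (.inr (.inl (k, l))))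
  eqr i := by
    ext k
    simpa [LinRow.toVec, conicRow] using congrFun h (.inr (.inr (.inr (.inl (i, k)))))
  eqf i := by
    ext k
    simpa [LinRow.toVec, conicRow] using congrFun h (.inr (.inr (.inr (.inr (.inl (i, k))))))
  eqr0 := by
    ext k
    simpa [LinRow.toVec, conicRow] using congrFun h (.inr (.inr (.inr (.inr (.inr (.inl k))))))
  eqw i := by
    simpa [LinRow.toVec, conicRow] using
      congrFun h (.inr (.inr (.inr (.inr (.inr (.inr (.inl i)))))))
  eqg i := by
    simpa [LinRow.toVec, conicRow] using
      congrFun h (.inr (.inr (.inr (.inr (.inr (.inr (.inr (.inl i))))))))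
  eqw0 := by
    simpa [LinRow.toVec, conicRow] using
      congrFun h (.inr (.inr (.inr (.inr (.inr (.inr (.inr (.inr (.inl ())))))))))
  eqT i := by
    ext k l
    simpa [LinRow.toVec, conicRow, Matrix.sum_apply] using
      congrFun h (.inr (.inr (.inr (.inr (.inr (.inr (.inr (.inr (.inr (.inl (i, k, l)))))))))))
  eqS i := by
    ext k l
    simpa [LinRow.toVec, conicRow, Matrix.sum_apply] using congrFun h
      (.inr (.inr (.inr (.inr (.inr (.inr (.inr (.inr (.inr (.inr (.inl (i, k, l))))))))))))
  eqT0 := by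
    ext k l
    simpa [LinRow.toVec, conicRow, Matrix.sum_apply] using congrFun h
      (.inr (.inr (.inr (.inr (.inr (.inr (.inr (.inr (.inr (.inr (.inr (k, l))))))))))))

/-- The tuple of coefficients with the symmetric parts of the matrices of `Z`. -/
noncomputable def SLCCoeffs.symmPart (Z : SLCCoeffs n) : SLCCoeffs n :=
  { Z with
    P := fun i => (1 / 2 : ℝ) • (Z.P i + (Z.P i).transpose)
    Q := fun i => (1 / 2 : ℝ) • (Z.Q i + (Z.Q i).transpose)
    P0 := (1 / 2 : ℝ) • (Z.P0 + Z.P0.transpose) }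

theorem SLCCoeffs.symmPart_isSymm (Z : SLCCoeffs n) : Z.symmPart.IsSymm :=
  ⟨fun _ => (Matrix.isSymm_add_transpose_self _).smul _,
    fun _ => (Matrix.isSymm_add_transpose_self _).smul _,
    (Matrix.isSymm_add_transpose_self _).smul _⟩

theorem matInner_symmPart {M : Matrix (Fin n) (Fin n) ℝ} (hM : M.IsSymm)
    (N : Matrix (Fin n) (Fin n) ℝ) :
    matInner M ((1 / 2 : ℝ) • (N + N.transpose)) = matInner M N := by
  have h : ∑ k, ∑ l, M k l * N l k = ∑ k, ∑ l, M k l * N k l := by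
    rw [Finset.sum_comm]
    exact Finset.sum_congr rfl fun k _ => Finset.sum_congr rfl fun l _ => by rw [hM.apply]
  have h2 : ∀ k l, M k l * ((1 / 2 : ℝ) * (N k l + N l k)) =
      (M k l * N k l + M k l * N l k) / 2 := fun k l => by ring
  simp only [matInner, Matrix.smul_apply, Matrix.add_apply, Matrix.transpose_apply, smul_eq_mul, h2,
    ← Finset.sum_div, Finset.sum_add_distrib, h]
  ring

/-- Lets the linear program range over all matrices: its solutions can be symmetrized afterwards, so
symmetry brings no extra multipliers into the dual. -/
theorem LinRow.IsSymm.eval_symmPart {a : LinRow n} (ha : a.IsSymm) (Z : SLCCoeffs n) :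
    a.eval Z.symmPart = a.eval Z := by
  simp only [LinRow.eval, SLCCoeffs.symmPart, matInner_symmPart (ha.1 _),
    matInner_symmPart (ha.2.1 _), matInner_symmPart ha.2.2]

/-! ### Finite and infinite values of $g_3$ -/

/-- The linear form `Z ↦ g₃(x, U, Z)` at a point where all the perspectives are finite. -/
noncomputable def g3Row (x : Fin n → ℝ) (U : Matrix (Fin n) (Fin n) ℝ) : LinRow n :=
  conicRow x U (fun i => perspMatrix (U i) (x i)) (fun i => perspMatrix (x - U i) (1 - x i))
    (perspMatrix x 1)

theorem g3Row_isSymm (x : Fin n → ℝ) (U : Matrix (Fin n) (Fin n) ℝ) : (g3Row x U).IsSymm :=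
  ⟨fun _ => perspMatrix_isSymm _ _, fun _ => perspMatrix_isSymm _ _, perspMatrix_isSymm _ _⟩

/-- The vectors `U_i` and `x - U_i` vanish where they are divided by `0`. -/
def FinitePersp (x : Fin n → ℝ) (U : Matrix (Fin n) (Fin n) ℝ) : Prop :=
  (∀ i, x i = 0 → U i = 0) ∧ ∀ i, 1 - x i = 0 → x - U i = 0

theorem ereal_coe_sum {α : Type*} (s : Finset α) (f : α → ℝ) :
    ((∑ i ∈ s, f i : ℝ) : EReal) = ∑ i ∈ s, (f i : EReal) := by
  classical
  induction s using Finset.induction_on with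
  | empty => simp
  | insert a s ha ih => rw [Finset.sum_insert ha, Finset.sum_insert ha, EReal.coe_add, ih]

theorem ereal_sum_ne_bot {α : Type*} (s : Finset α) (f : α → EReal) (h : ∀ i, f i ≠ ⊥) :
    ∑ i ∈ s, f i ≠ ⊥ := by
  classical
  induction s using Finset.induction_on with
  | empty => simp
  | insert a s ha ih =>
    rw [Finset.sum_insert ha, Ne, EReal.add_eq_bot_iff]
    exact not_or.2 ⟨h a, ih⟩

theorem g3_eq {x : Fin n → ℝ} {U : Matrix (Fin n) (Fin n) ℝ} (h : FinitePersp x U)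
    (Z : SLCCoeffs n) : g3 x U Z = ((g3Row x U).eval Z : ℝ) := by
  simp only [g3, quadOverLin_eq _ (h.1 _), quadOverLin_eq _ (h.2 _), ← EReal.coe_add,
    ← ereal_coe_sum, EReal.coe_eq_coe_iff]
  have h0 : matInner (perspMatrix x 1) Z.P0 = x ⬝ᵥ Z.P0.mulVec x := by
    rw [matInner_perspMatrix, div_one]
  simp only [LinRow.eval, g3Row, conicRow, h0, Finset.sum_add_distrib]
  simp only [mul_comm (Z.w _)]
  ring

theorem g3_eq_top {x : Fin n → ℝ} {U : Matrix (Fin n) (Fin n) ℝ} {Z : SLCCoeffs n} {i : Fin n}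
    (h : quadOverLin (Z.P i) (U i) (x i) = ⊤ ∨ quadOverLin (Z.Q i) (x - U i) (1 - x i) = ⊤) :
    g3 x U Z = ⊤ := by
  have key : ∀ p q : EReal, p ≠ ⊥ → q ≠ ⊥ → ∀ a b : ℝ, p + a + q + b ≠ ⊥ := by
    intro p q hp hq a b
    simp [EReal.add_eq_bot_iff, hp, hq]
  have key2 : ∀ p q : EReal, p ≠ ⊥ → q ≠ ⊥ → (p = ⊤ ∨ q = ⊤) → ∀ a b : ℝ, p + a + q + b = ⊤ := by
    rintro p q hp hq (rfl | rfl) a b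
    · rw [EReal.top_add_coe, EReal.top_add_of_ne_bot hq, EReal.top_add_coe]
    · rw [EReal.add_top_of_ne_bot (by simp [EReal.add_eq_bot_iff, hp]), EReal.top_add_coe]
  rw [g3, ← Finset.add_sum_erase _ _ (Finset.mem_univ i),
    key2 _ _ (quadOverLin_ne_bot _ _ _) (quadOverLin_ne_bot _ _ _) h]
  exact (congrArg (· + _) (EReal.top_add_of_ne_bot (ereal_sum_ne_bot _ _ fun j =>
    key _ _ (quadOverLin_ne_bot _ _ _) (quadOverLin_ne_bot _ _ _) _ _))).trans
      (EReal.top_add_coe _)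

/-- Pairing $M-I$ with $uu^T$ gives $u^TMu\ge u^Tu>0$. -/
theorem quadOverLin_eq_top {M : Matrix (Fin n) (Fin n) ℝ} (hs : M.IsSymm)
    (hM : IsDiagDominant (M - 1)) {u : Fin n → ℝ} (hu : u ≠ 0) : quadOverLin M u 0 = ⊤ := by
  have h1 : (Matrix.vecMulVec u u).PosSemidef := by
    simpa using Matrix.posSemidef_vecMulVec_self_star u
  have h2 := matInner_nonneg_of_isDiagDominant h1 (hs.sub Matrix.isSymm_one) hM
  rw [matInner_vecMulVec, Matrix.sub_mulVec, dotProduct_sub, Matrix.one_mulVec] at h2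
  have h3 : 0 < u ⬝ᵥ u := lt_of_le_of_ne (Finset.sum_nonneg fun i _ => mul_self_nonneg _)
    fun h0 => hu (dotProduct_self_eq_zero.1 h0.symm)
  have h4 : u ⬝ᵥ M.mulVec u ≠ 0 := by linarith
  simp [quadOverLin, h4]

theorem exists_g3_eq_top {p : MvPolynomial (Fin n) ℝ} (hp : p.totalDegree ≤ 3)
    {E : EqSystem n ι} (hE : E.IsMatching p) {I : IneqSystem n κ} (hI : I.IsGershgorin)
    {x : Fin n → ℝ} {U : Matrix (Fin n) (Fin n) ℝ} (h : ¬FinitePersp x U) :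
    ∃ Z ∈ gershSet E I, g3 x U Z = ⊤ := by
  obtain ⟨Z, hZ, hpoly, hdd, hP, hQ⟩ := exists_slcCoeffs_isDiagDominant p hp
  refine ⟨Z, ⟨hZ, (hE.2 Z hZ).2 hpoly, (hI.2 Z hZ).2 hdd⟩, ?_⟩
  rw [FinitePersp, not_and_or] at h
  rcases h with h | h <;> push Not at h <;> obtain ⟨i, hx, hU⟩ := h
  · refine g3_eq_top (i := i) (.inl ?_)
    rw [hx]
    exact quadOverLin_eq_top (hZ.1 i) (hP i) hU
  · refine g3_eq_top (i := i) (.inr ?_)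
    rw [hx]
    exact quadOverLin_eq_top (hZ.2.1 i) (hQ i) hU

theorem gershSet_nonempty {p : MvPolynomial (Fin n) ℝ} (hp : p.totalDegree ≤ 3)
    {E : EqSystem n ι} (hE : E.IsMatching p) {I : IneqSystem n κ} (hI : I.IsGershgorin) :
    (gershSet E I).Nonempty := by
  obtain ⟨Z, hZ, hpoly, hdd, -⟩ := exists_slcCoeffs_isDiagDominant p hp
  exact ⟨Z, hZ, (hE.2 Z hZ).2 hpoly, (hI.2 Z hZ).2 hdd⟩

/-! ### Weak and strong duality at a point -/

variable [Fintype ι] [Fintype κ]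

theorem ConicFeasible.finitePersp {E : EqSystem n ι} {I : IneqSystem n κ} {x : Fin n → ℝ}
    {U : Matrix (Fin n) (Fin n) ℝ} {v : ConicVars n ι κ} (hv : ConicFeasible E I x U v)
    (hx : ∀ i, x i ∈ Set.Icc (0 : ℝ) 1) : FinitePersp x U :=
  ⟨fun i => ((borderedMatrix_posSemidef_iff (hx i).1).1 (hv.lmiP i)).1,
    fun i => ((borderedMatrix_posSemidef_iff (sub_nonneg.2 (hx i).2)).1 (hv.lmiQ i)).1⟩

theorem g3_le_conicObj {E : EqSystem n ι} {I : IneqSystem n κ} (hI : I.IsGershgorin)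
    {x : Fin n → ℝ} (hx : ∀ i, x i ∈ Set.Icc (0 : ℝ) 1) {U : Matrix (Fin n) (Fin n) ℝ}
    {v : ConicVars n ι κ} (hv : ConicFeasible E I x U v) {Z : SLCCoeffs n}
    (hZ : Z ∈ gershSet E I) : g3 x U Z ≤ conicObj E I v := by
  obtain ⟨hs, hEZ, hIZ⟩ := hZ
  have hdd := (hI.2 Z hs).1 hIZ
  obtain ⟨t, ht⟩ := hIZ
  rw [g3_eq (hv.finitePersp hx), EReal.coe_le_coe_iff]
  -- The Schur complements are positive semidefinite and the matrices of `Z` dominant, so passing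
  -- from the rank-one matrices to $Y,R$ only raises the value.
  have h1 : (g3Row x U).eval Z ≤ (conicRow x U v.Y v.R v.Y0).eval Z := by
    have hP := fun i => matInner_nonneg_of_isDiagDominant
      ((borderedMatrix_posSemidef_iff (hx i).1).1 (hv.lmiP i)).2 (hs.1 i) (hdd.1 i)
    have hQ := fun i => matInner_nonneg_of_isDiagDominant
      ((borderedMatrix_posSemidef_iff (sub_nonneg.2 (hx i).2)).1 (hv.lmiQ i)).2 (hs.2.1 i)
      (hdd.2.1 i)
    have hP0 := matInner_nonneg_of_isDiagDominant
      ((borderedMatrix_posSemidef_iff zero_le_one).1 hv.lmiP0).2 hs.2.2 hdd.2.2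
    simp only [matInner_sub, sub_nonneg] at hP hQ hP0
    simp only [LinRow.eval, g3Row, conicRow]
    gcongr with i
    · exact hP i
    · exact hQ i
  -- The usual weak duality: pair the dual equation with the primal point.
  have h2 := congrArg (· ⬝ᵥ Z.toVec t) hv.vec_eq
  simp only [sub_dotProduct, add_dotProduct, sum_dotProduct, smul_dotProduct,
    toVec_dotProduct_toVec, hEZ _, smul_eq_mul, zero_dotProduct, Pi.zero_apply, matInner_zero,
    Finset.sum_const_zero, add_zero] at h2
  have h3 : ∑ j, v.theta j * ((I.row j).eval Z +
      (∑ i, (matInner (I.H j i) (t.T i) + matInner (I.G j i) (t.S i))) +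
      matInner (I.Psi j) t.T0) ≤ ∑ j, v.theta j * I.s j :=
    Finset.sum_le_sum fun j _ => mul_le_mul_of_nonneg_left (ht j) (hv.theta_nonneg j)
  rw [conicObj]
  linarith

theorem exists_conicFeasible_of_bounded {E : EqSystem n ι} (hE : ∀ j, (E.row j).IsSymm)
    {I : IneqSystem n κ} (hI : ∀ j, (I.row j).IsSymm) (hne : (gershSet E I).Nonempty)
    {x : Fin n → ℝ} (hx : ∀ i, x i ∈ Set.Icc (0 : ℝ) 1) {U : Matrix (Fin n) (Fin n) ℝ}
    (hf : FinitePersp x U) {B : ℝ} (hB : ∀ Z ∈ gershSet E I, (g3Row x U).eval Z ≤ B) :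
    ∃ Z ∈ gershSet E I, ∃ v : ConicVars n ι κ, ConicFeasible E I x U v ∧
      (conicObj E I v : EReal) ≤ g3 x U Z := by
  have hsymm : ∀ (Z : SLCCoeffs n) (t : AuxVars n),
      (∀ j, (E.row j).toVec 0 0 0 ⬝ᵥ Z.toVec t = E.s j) →
      (∀ j, (I.row j).toVec (I.H j) (I.G j) (I.Psi j) ⬝ᵥ Z.toVec t ≤ I.s j) →
      Z.symmPart ∈ gershSet E I := fun Z t h1 h2 => by
    refine ⟨Z.symmPart_isSymm, fun j => ?_, t, fun j => ?_⟩
    · rw [(hE j).eval_symmPart, ← h1 j, toVec_dotProduct_toVec_zero]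
    · rw [(hI j).eval_symmPart, ← toVec_dotProduct_toVec]
      exact h2 j
  obtain ⟨z, hz1, hz2, l, θ, hθ, heq, hobj⟩ := linearProgram_duality
    (fun j => (E.row j).toVec 0 0 0) E.s
    (fun j => (I.row j).toVec (I.H j) (I.G j) (I.Psi j)) I.s ((g3Row x U).toVec 0 0 0) B
    (by
      obtain ⟨Z, -, hEZ, t, ht⟩ := hne
      refine ⟨Z.toVec t, fun j => ?_, fun j => ?_⟩
      · rw [toVec_dotProduct_toVec_zero, hEZ j]
      · rw [toVec_dotProduct_toVec]
        exact ht j)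
    (fun z h1 h2 => by
      obtain ⟨Z, t, rfl⟩ := exists_toVec_eq z
      rw [toVec_dotProduct_toVec_zero, ← (g3Row_isSymm x U).eval_symmPart]
      exact hB _ (hsymm Z t h1 h2))
  obtain ⟨Z, t, rfl⟩ := exists_toVec_eq z
  -- The rank-one matrices themselves complete the dual solution: all Schur complements are zero.
  refine ⟨Z.symmPart, hsymm Z t hz1 hz2, ⟨fun i => perspMatrix (U i) (x i),
    fun i => perspMatrix (x - U i) (1 - x i), perspMatrix x 1, l, θ⟩,
    conicFeasible_of_vec_eq heq (fun i => ?_) (fun i => ?_) ?_ hθ, ?_⟩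
  · rw [borderedMatrix_posSemidef_iff (hx i).1, sub_self]
    exact ⟨hf.1 i, .zero⟩
  · rw [borderedMatrix_posSemidef_iff (sub_nonneg.2 (hx i).2), sub_self]
    exact ⟨hf.2 i, .zero⟩
  · rw [borderedMatrix_posSemidef_iff zero_le_one, sub_self]
    exact ⟨fun h => absurd h one_ne_zero, .zero⟩
  · rw [toVec_dotProduct_toVec_zero] at hobj
    rw [g3_eq hf, (g3Row_isSymm x U).eval_symmPart, EReal.coe_le_coe_iff]
    exact hobj

/-- Any feasible conic point supplies, by weak duality, both finite perspectives and the bound that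
strong duality needs. -/
theorem exists_conicFeasible_conicObj_le {p : MvPolynomial (Fin n) ℝ} (hp : p.totalDegree ≤ 3)
    {E : EqSystem n ι} (hE : E.IsMatching p) {I : IneqSystem n κ} (hI : I.IsGershgorin)
    {x : Fin n → ℝ} (hx : ∀ i, x i ∈ Set.Icc (0 : ℝ) 1) {U : Matrix (Fin n) (Fin n) ℝ}
    (h : ∃ v : ConicVars n ι κ, ConicFeasible E I x U v) :
    ∃ Z ∈ gershSet E I, ∃ v : ConicVars n ι κ, ConicFeasible E I x U v ∧
      (conicObj E I v : EReal) ≤ g3 x U Z := by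
  obtain ⟨v, hv⟩ := h
  have hf := hv.finitePersp hx
  refine exists_conicFeasible_of_bounded hE.1 hI.1 (gershSet_nonempty hp hE hI) hx hf
    (B := conicObj E I v) fun Z hZ => ?_
  have := g3_le_conicObj hI hx hv hZ
  rwa [g3_eq hf, EReal.coe_le_coe_iff] at this

theorem tightestBound_eq_top {p : MvPolynomial (Fin n) ℝ} (hp : p.totalDegree ≤ 3)
    {E : EqSystem n ι} (hE : E.IsMatching p) {I : IneqSystem n κ} (hI : I.IsGershgorin)
    {z : (Fin n → ℝ) × Matrix (Fin n) (Fin n) ℝ} (hx : ∀ i, z.1 i ∈ Set.Icc (0 : ℝ) 1)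
    (h : ¬∃ v : ConicVars n ι κ, ConicFeasible E I z.1 z.2 v) : tightestBound E I z = ⊤ := by
  by_cases hf : FinitePersp z.1 z.2
  · rw [EReal.eq_top_iff_forall_lt]
    intro B
    by_contra! hB
    obtain ⟨Z, -, v, hv, -⟩ := exists_conicFeasible_of_bounded hE.1 hI.1
      (gershSet_nonempty hp hE hI) hx hf (B := B) fun Z hZ => by
        rw [← EReal.coe_le_coe_iff, ← g3_eq hf]
        exact (le_iSup₂ (f := fun Z _ => g3 z.1 z.2 Z) Z hZ).trans hB
    exact h ⟨v, hv⟩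
  · obtain ⟨Z, hZ, htop⟩ := exists_g3_eq_top hp hE hI hf
    exact top_le_iff.1 (htop ▸ le_iSup₂ (f := fun Z _ => g3 z.1 z.2 Z) Z hZ)

theorem tightestBound_eq {p : MvPolynomial (Fin n) ℝ} (hp : p.totalDegree ≤ 3)
    {E : EqSystem n ι} (hE : E.IsMatching p) {I : IneqSystem n κ} (hI : I.IsGershgorin)
    {z : (Fin n → ℝ) × Matrix (Fin n) (Fin n) ℝ} (hx : ∀ i, z.1 i ∈ Set.Icc (0 : ℝ) 1) :
    tightestBound E I z =
      ⨅ v ∈ {v : ConicVars n ι κ | ConicFeasible E I z.1 z.2 v}, (conicObj E I v : EReal) := by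
  refine le_antisymm (iSup₂_le fun Z hZ => le_iInf₂ fun v hv => g3_le_conicObj hI hx hv hZ) ?_
  by_cases h : ∃ v : ConicVars n ι κ, ConicFeasible E I z.1 z.2 v
  · obtain ⟨Z, hZ, v, hv, hle⟩ := exists_conicFeasible_conicObj_le hp hE hI hx h
    exact (iInf₂_le v hv).trans (hle.trans (le_iSup₂ (f := fun Z _ => g3 z.1 z.2 Z) Z hZ))
  · rw [tightestBound_eq_top hp hE hI hx h]
    exact le_top

end ConicDuality

/-! ### The min-max problem -/

theorem mainTheorem8 {n : ℕ} {ι κ : Type*} [Fintype ι] [Fintype κ]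
    (p : MvPolynomial (Fin n) ℝ) (hp : p.totalDegree ≤ 3)
    (E : EqSystem n ι) (hE : E.IsMatching p)
    (I : IneqSystem n κ) (hI : I.IsGershgorin)
    (Xbar : Set ((Fin n → ℝ) × Matrix (Fin n) (Fin n) ℝ))
    (hX : ∀ z ∈ Xbar, ∀ i, z.1 i ∈ Set.Icc (0 : ℝ) 1) :
    -- for a given point `(x, U)`: equality of the optimal values, and attainment
    (∀ z ∈ Xbar,
      (tightestBound E I z =
          ⨅ v ∈ {v : ConicVars n ι κ | ConicFeasible E I z.1 z.2 v}, (conicObj E I v : EReal)) ∧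
      ((∃ v : ConicVars n ι κ, ConicFeasible E I z.1 z.2 v) →
        ∃ Z ∈ gershSet E I, ∃ v ∈ {v : ConicVars n ι κ | ConicFeasible E I z.1 z.2 v},
          IsMaxOn (g3 z.1 z.2) (gershSet E I) Z ∧
          IsMinOn (conicObj E I) {v : ConicVars n ι κ | ConicFeasible E I z.1 z.2 v} v ∧
          g3 z.1 z.2 Z = (conicObj E I v : EReal))) ∧
    -- for `(x, U)` minimized over `Xbar`: equality of the optimal values
    ((⨅ z ∈ Xbar, tightestBound E I z) =
        ⨅ q ∈ conicSet E I Xbar, (conicObj E I q.2 : EReal)) ∧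
    -- for `(x, U)` minimized over `Xbar`: correspondence of the optimal solutions
    (∀ z : (Fin n → ℝ) × Matrix (Fin n) (Fin n) ℝ,
      (z ∈ Xbar ∧ tightestBound E I z ≠ ⊤ ∧ IsMinOn (tightestBound E I) Xbar z) ↔
        ∃ v : ConicVars n ι κ, (z, v) ∈ conicSet E I Xbar ∧
          IsMinOn (fun q => conicObj E I q.2) (conicSet E I Xbar) (z, v)) := by
  have heq := fun z (hz : z ∈ Xbar) => tightestBound_eq hp hE hI (hX z hz)
  have hatt := fun z (hz : z ∈ Xbar) (h : ∃ v, ConicFeasible E I z.1 z.2 v) =>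
    exists_conicFeasible_conicObj_le hp hE hI (hX z hz) h
  have hle : ∀ z ∈ Xbar, ∀ v, ConicFeasible E I z.1 z.2 v →
      tightestBound E I z ≤ conicObj E I v := fun z hz v hv => by
    rw [heq z hz]
    exact iInf₂_le v hv
  refine ⟨fun z hz => ⟨heq z hz, fun h => ?_⟩, ?_, fun z => ⟨?_, ?_⟩⟩
  · obtain ⟨Z, hZ, v, hv, hvZ⟩ := hatt z hz h
    have hweak := fun v' (hv' : ConicFeasible E I z.1 z.2 v') Z' (hZ' : Z' ∈ gershSet E I) =>
      g3_le_conicObj hI (hX z hz) hv' hZ'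
    exact ⟨Z, hZ, v, hv, fun Z' hZ' => (hweak v hv Z' hZ').trans hvZ,
      fun v' hv' => EReal.coe_le_coe_iff.1 (hvZ.trans (hweak v' hv' Z hZ)),
      le_antisymm (hweak v hv Z hZ) hvZ⟩
  · refine le_antisymm (le_iInf₂ fun q hq => (iInf₂_le q.1 hq.1).trans (hle q.1 hq.1 q.2 hq.2))
      (le_iInf₂ fun z hz => ?_)
    rw [heq z hz]
    exact le_iInf₂ fun v hv =>
      iInf₂_le (f := fun q (_ : q ∈ conicSet E I Xbar) => (conicObj E I q.2 : EReal)) (z, v) ⟨hz, hv⟩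
  · rintro ⟨hz, htop, hmin⟩
    have hfeas : ∃ v, ConicFeasible E I z.1 z.2 v := by
      by_contra h
      exact htop (tightestBound_eq_top hp hE hI (hX z hz) h)
    -- Attainment is essential here: `v` must realize the tightest bound at `z`.
    obtain ⟨Z, hZ, v, hv, hvZ⟩ := hatt z hz hfeas
    refine ⟨v, ⟨hz, hv⟩, fun q hq => EReal.coe_le_coe_iff.1 (hvZ.trans ?_)⟩
    exact (le_iSup₂ (f := fun Z _ => g3 z.1 z.2 Z) Z hZ).trans
      ((hmin hq.1).trans (hle q.1 hq.1 q.2 hq.2))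
  · rintro ⟨v, ⟨hz, hv⟩, hmin⟩
    have h1 := hle z hz v hv
    refine ⟨hz, ne_top_of_le_ne_top (EReal.coe_ne_top _) h1, fun z' hz' => h1.trans ?_⟩
    -- In this direction equality of values suffices: the bound at `z'` is an infimum over conic
    -- points, none of which beats `v`.
    rw [heq z' hz']
    exact le_iInf₂ fun v' hv' =>
      EReal.coe_le_coe_iff.2 (hmin (show (z', v') ∈ conicSet E I Xbar from ⟨hz', hv'⟩))
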